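/- Let $(A,Q)$ be a finite quadratic module ($Q:A\to\mathbb Q/\mathbb Z$ a nondegenerate quadratic form) with $|A|=p$ an odd prime, and fix an identification $A\cong\mathbb Z/p\mathbb Z$ and $\alpha\in\mathbb Z$ with $Q(\gamma)=\alpha\gamma^2/p$. Write $\langle\beta,\gamma\rangle=Q(\beta+\gamma)-Q(\beta)-Q(\gamma)$, $\mathbf e(x)=e^{2\pi i x}$, $q=\mathbf e(\tau)$, and let $\mathrm{sig}\in\mathbb Z/8\mathbb Z$ be the signature, $\mathbf e(\mathrm{sig}/8)=p^{-1/2}\sum_{\gamma\in A}\mathbf e(Q(\gamma))$ (it is even). Let $\rho^*$ be the dual Weil representation of $\mathrm{Mp}_2(\mathbb Z)$ on $\mathbb C[A]$, given by $\rho^*(T)\mathfrak e_\gamma=\mathbf e(-Q(\gamma))\mathfrak e_\gamma$ and $\rho^*(S)\mathfrak e_\gamma=\frac{\mathbf e(\mathrm{sig}/8)}{\sqrt p}\sum_{\beta}\mathbf e(\langle\beta,\gamma\rangle)\mathfrak e_\beta$. For $k\in\mathbb Z$ let $A_k(\rho^*)$ be the space of weakly holomorphic modular forms of weight $k$ for $\rho^*$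 (holomorphic on $\mathbb H$, meromorphic at $\infty$). Let $\chi_p=(\frac{\cdot}{p})$ and let $\chi$ be a Dirichlet character mod $p$ with $\chi(-1)=(-1)^{k+\mathrm{sig}/2}$. Let $A_k(p^2,\chi\otimes\chi_p)$ be the space of weakly holomorphic modular forms of weight $k$ for $\Gamma_0(p^2)$ with character $\chi\otimes\chi_p$ (holomorphic on $\mathbb H$, meromorphic at the cusps). A form $G=\sum_{n\gg-\infty}c(n)q^n$ in it satisfies the $\epsilon$-condition if $c(n)=0$ unless $n\in p(\mathbb Z-Q(\gamma))$ for some $\gamma\neq0$. For such $G$ put, for $\gamma\ne 0$, $G_\gamma=\frac12\sum_{n\in p(\mathbb Z-Q(\gamma))}c(n)q^n$, so that $G=\sum_{\gamma\neq0}G_\gamma$, and $G_\psi=\sum_{\gamma\ne0}\psi(\gamma)G_\gamma$ for a Dirichlet character $\psi$ mod $p$. Put $(f|_kW_{p^2})(\tau)=p^k(p^2\tau)^{-k}f(-1/(p^2\tau))$. The form $G$ satisfies the Atkin–Lehner condition if for all Dirichlet characters $\psi\neq\overline\chi$ mod $p$ $$G_\psi|_kW_{p^2}=\overline{\psi\chi(2\alpha)}\,\frac{g(\psi\chi)}{\sqrt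 p}\,\mathbf e(\mathrm{sig}/8)\,G_{\overline\psi\,\overline\chi^2},\qquad g(\psi\chi)=\sum_{n\in(\mathbb Z/p\mathbb Z)^*}\psi\chi(n)\mathbf e(n/p).$$ Let $A_k^{\epsilon,\mathrm{AL}}(p^2,\chi\otimes\chi_p)$ be the subspace of $A_k(p^2,\chi\otimes\chi_p)$ of forms satisfying the $\epsilon$-condition and the Atkin–Lehner condition. For $F=\sum_\gamma F_\gamma\mathfrak e_\gamma$ put $\varphi_\chi(F)(\tau)=\sum_{\gamma\ne0}\chi(\gamma)F_\gamma(p\tau)$, and for $G$ as above put $$\Psi_\chi(G)(\tau)=\sum_{\gamma\neq0}\overline{\chi(\gamma)}G_\gamma(\tau/p)\mathfrak e_\gamma+G_0(\tau/p)\mathfrak e_0,\qquad G_0=\frac{\sqrt p}{p-1}\mathbf e(-\mathrm{sig}/8)\,G_{\overline\chi}|_kW_{p^2}+\frac1{p-1}G_{\overline\chi}.$$ **Proposition 3.3.** For every $F\in A_k(\rho^*)$ we have $\varphi_\chi(F)\in A_k^{\epsilon,\mathrm{AL}}(p^2,\chi\otimes\chi_p)$ and $\Psi_\chi(\varphi_\chi(F))=F$.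 Moreover, except when $p=3$ and $\chi$ is the trivial character mod $3$, the map $\varphi_\chi:A_k(\rho^*)\to A_k^{\epsilon,\mathrm{AL}}(p^2,\chi\otimes\chi_p)$ is an isomorphism of complex vector spaces with inverse $\Psi_\chi$. -/

import Mathlib

open scoped UpperHalfPlane MatrixGroups Manifold ModularForm ComplexConjugate
open UpperHalfPlane

noncomputable section

namespace TwistedSum

/-! ### The exponential `𝐞(x) = exp(2πix)` and finite quadratic modules -/

/-- `𝐞(x) = exp(2πix)` for `x ∈ ℚ/ℤ`. -/
def eQZ : AddCircle (1 : ℚ) → ℂ :=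
  Function.Periodic.lift (f := fun x : ℚ => Complex.exp (2 * Real.pi * Complex.I * x)) (by
    intro x
    have h : 2 * (Real.pi : ℂ) * Complex.I * ((x + 1 : ℚ) : ℂ)
        = 2 * Real.pi * Complex.I * x + 2 * Real.pi * Complex.I := by
      push_cast; ring
    simp only [h, Complex.exp_add, Complex.exp_two_pi_mul_I, mul_one])

lemma eQZ_coe (x : ℚ) : eQZ (x : AddCircle (1 : ℚ)) = Complex.exp (2 * Real.pi * Complex.I * x) :=
  rfl

/-- `q^n = exp(2πinτ)` for a rational exponent `n`. -/
def qpow (n : ℚ) (τ : ℍ) : ℂ := Complex.exp (2 * Real.pi * Complex.I * n * τ)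

section QuadraticModule

variable {A : Type*} [AddCommGroup A]

/-- A `ℚ/ℤ`-valued quadratic form is nondegenerate if the bilinear form
`⟨β, γ⟩ = Q(β + γ) - Q(β) - Q(γ)` has trivial radical. -/
def IsNondegenerate (Q : QuadraticMap ℤ A (AddCircle (1 : ℚ))) : Prop :=
  ∀ γ : A, (∀ β : A, QuadraticMap.polar Q β γ = 0) → γ = 0

variable [Fintype A]

/-- The signature: the class `s` mod `8` with `𝐞(s/8) = |A|^{-1/2} ∑_γ 𝐞(Q(γ))`. -/
def signature (Q : QuadraticMap ℤ A (AddCircle (1 : ℚ))) : ZMod 8 :=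
  Classical.epsilon fun s : ZMod 8 =>
    Complex.exp (2 * Real.pi * Complex.I * ((s.val : ℂ) / 8))
      = ((Real.sqrt (Fintype.card A) : ℝ) : ℂ)⁻¹ * ∑ γ : A, eQZ (Q γ)

/-- The number `𝐞(sig(A,Q)/8)`. -/
def eSig8 (Q : QuadraticMap ℤ A (AddCircle (1 : ℚ))) : ℂ :=
  Complex.exp (2 * Real.pi * Complex.I * (((signature Q).val : ℂ) / 8))

/-- The integer `sig(A,Q)/2` for the representative of the signature in `{0, …, 7}` (used when the
signature is even; it is then well defined mod `4`). -/
def halfSig (Q : QuadraticMap ℤ A (AddCircle (1 : ℚ))) : ℤ :=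
  ((signature Q).val : ℤ) / 2

end QuadraticModule

/-! ### The metaplectic group and the dual Weil representation -/

/-- Elements of `Mp₂(ℤ)`: a matrix in `SL₂(ℤ)` with a continuous (hence holomorphic) square root of
`cτ + d` on the upper half-plane. -/
@[ext]
structure Mp2Z where
  mat : SL(2, ℤ)
  root : ℍ → ℂ
  cont : Continuous root
  sq : ∀ τ : ℍ, root τ ^ 2 = denom mat τ

namespace Mp2Z

lemma denom_mul (g h : SL(2, ℤ)) (τ : ℍ) :
    denom ((g * h : SL(2, ℤ)) : GL (Fin 2) ℝ) τ
      = denom (g : GL (Fin 2) ℝ) (h • τ : ℍ) * denom (h : GL (Fin 2) ℝ) τ := by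
  have h1 := denom_cocycle (g : GL (Fin 2) ℝ) (h : GL (Fin 2) ℝ) τ.im_ne_zero
  rw [map_mul, map_mul, h1]
  congr 2
  have := UpperHalfPlane.coe_smul_of_det_pos (g := (h : GL (Fin 2) ℝ)) (by simp) τ
  rw [← this]; rfl

lemma continuous_smul (g : SL(2, ℤ)) : Continuous fun τ : ℍ => g • τ := by
  have : Continuous fun τ : ℍ => (g : GL (Fin 2) ℝ) • τ := continuous_const_smul _
  exact this

lemma root_ne_zero (x : Mp2Z) (τ : ℍ) : x.root τ ≠ 0 := by
  intro h
  have := x.sq τ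
  rw [h] at this
  exact denom_ne_zero (x.mat : GL (Fin 2) ℝ) τ (by simpa using this.symm)

/-- `(g, φ)(h, ψ) = (gh, φ(hτ)ψ(τ))`. -/
instance : Mul Mp2Z where
  mul x y :=
    { mat := x.mat * y.mat
      root := fun τ => x.root (y.mat • τ) * y.root τ
      cont := (x.cont.comp (continuous_smul y.mat)).mul y.cont
      sq := fun τ => by rw [mul_pow, x.sq, y.sq, denom_mul] }

instance : One Mp2Z where
  one := { mat := 1, root := fun _ => 1, cont := continuous_const, sq := fun τ => by simp }

instance : Inv Mp2Z where
  inv x :=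
    { mat := x.mat⁻¹
      root := fun τ => (x.root (x.mat⁻¹ • τ))⁻¹
      cont := (x.cont.comp (continuous_smul _)).inv₀ fun τ => x.root_ne_zero _
      sq := fun τ => by
        have h := denom_mul x.mat x.mat⁻¹ τ
        rw [mul_inv_cancel] at h
        have h1 : denom ((1 : SL(2, ℤ)) : GL (Fin 2) ℝ) τ = 1 := by simp
        rw [h1] at h
        rw [inv_pow, x.sq]
        exact (eq_inv_of_mul_eq_one_right h.symm).symm }

@[simp] lemma mul_mat (x y : Mp2Z) : (x * y).mat = x.mat * y.mat := rfl
@[simp] lemma mul_root (x y : Mp2Z) (τ : ℍ) :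
    (x * y).root τ = x.root (y.mat • τ) * y.root τ := rfl
@[simp] lemma one_mat : (1 : Mp2Z).mat = 1 := rfl
@[simp] lemma one_root (τ : ℍ) : (1 : Mp2Z).root τ = 1 := rfl
@[simp] lemma inv_mat (x : Mp2Z) : (x⁻¹).mat = x.mat⁻¹ := rfl
@[simp] lemma inv_root (x : Mp2Z) (τ : ℍ) : (x⁻¹).root τ = (x.root (x.mat⁻¹ • τ))⁻¹ := rfl

instance : Group Mp2Z :=
  Group.ofLeftAxioms
    (fun x y z => Mp2Z.ext (mul_assoc _ _ _) (by
      funext τ; simp only [mul_root, mul_mat, mul_smul, mul_assoc]))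
    (fun x => Mp2Z.ext (one_mul _) (by funext τ; simp))
    (fun x => Mp2Z.ext (inv_mul_cancel _) (by
      funext τ
      simp [inv_mul_cancel₀ (x.root_ne_zero τ)]))

/-- The generator `S = ((0, -1; 1, 0), √τ)` (principal branch). -/
def genS : Mp2Z where
  mat := ModularGroup.S
  root := fun τ => (τ : ℂ) ^ (1 / 2 : ℂ)
  cont := by
    refine continuous_iff_continuousAt.2 fun τ => ?_
    refine UpperHalfPlane.continuous_coe.continuousAt.cpow continuousAt_const ?_
    exact Or.inr (by simpa using τ.im_ne_zero)
  sq := fun τ => by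
    rw [ModularGroup.denom_S, ← Complex.cpow_nat_mul]
    simp

/-- The generator `T = ((1, 1; 0, 1), 1)`. -/
def genT : Mp2Z where
  mat := ModularGroup.T
  root := fun _ => 1
  cont := continuous_const
  sq := fun τ => by
    have h : denom ((ModularGroup.T : SL(2, ℤ)) : GL (Fin 2) ℝ) τ = 1 := by
      rw [ModularGroup.denom_apply]; simp [ModularGroup.T]
    rw [h, one_pow]

end Mp2Z

section Weil

variable {A : Type*} [AddCommGroup A] [Fintype A] [DecidableEq A]

/-- `ρ*(T) 𝔢_γ = 𝐞(-Q(γ)) 𝔢_γ` on `ℂ[A] = (A → ℂ)`. -/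
def rhoT (Q : QuadraticMap ℤ A (AddCircle (1 : ℚ))) : Module.End ℂ (A → ℂ) :=
  Matrix.toLin' (Matrix.diagonal fun γ => eQZ (-(Q γ)))

/-- `ρ*(S) 𝔢_γ = 𝐞(sig/8) |A|^{-1/2} ∑_β 𝐞(⟨β, γ⟩) 𝔢_β` on `ℂ[A] = (A → ℂ)`. -/
def rhoS (Q : QuadraticMap ℤ A (AddCircle (1 : ℚ))) : Module.End ℂ (A → ℂ) :=
  Matrix.toLin' (Matrix.of fun β γ =>
    eSig8 Q / ((Real.sqrt (Fintype.card A) : ℝ) : ℂ) * eQZ (QuadraticMap.polar Q β γ))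

/-- The graph `{(x, ρ*(x)) : x ∈ Mp₂(ℤ)}` of the dual Weil representation, which is defined on the
generators: it consists of the pairs obtained by multiplying out a word in `S, T` and the same word
in `ρ*(S), ρ*(T)`. (Every element of `Mp₂(ℤ)` is a positive word in `S` and `T`, because `S⁸ = 1`
and `(ST)³ = S²`.) -/
def dualWeilGraph (Q : QuadraticMap ℤ A (AddCircle (1 : ℚ))) :
    Submonoid (Mp2Z × Module.End ℂ (A → ℂ)) :=
  Submonoid.closure {(Mp2Z.genS, rhoS Q), (Mp2Z.genT, rhoT Q)}

end Weil

/-! ### Fourier expansions -/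

/-- `f = ∑_{n ∈ ℚ, n ≫ -∞} c(n) q^n`. -/
def HasFourierExpansion (f : ℍ → ℂ) (c : ℚ → ℂ) : Prop :=
  (∃ B : ℚ, ∀ n < B, c n = 0) ∧ ∀ τ : ℍ, HasSum (fun n : ℚ => c n * qpow n τ) (f τ)

/-- `f` is meromorphic at `∞`: for some `h ≥ 1` it is a Laurent series in `q^{1/h}` with finite
principal part. -/
def MeromorphicAtInfty (f : ℍ → ℂ) : Prop :=
  ∃ h : ℕ, 0 < h ∧ ∃ c : ℚ → ℂ,
    (∀ n, c n ≠ 0 → ∃ m : ℤ, (h : ℚ) * n = m) ∧ HasFourierExpansion f c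

/-- `f = ∑_{n ∈ ℤ, n ≫ -∞} c(n) q^n`. -/
def HasQExpansion (f : ℍ → ℂ) (c : ℤ → ℂ) : Prop :=
  (∃ B : ℤ, ∀ n < B, c n = 0) ∧ ∀ τ : ℍ, HasSum (fun n : ℤ => c n * qpow n τ) (f τ)

/-- The coefficients of the expansion `∑_{n ≫ -∞} c(n) q^n` of `f`, if there is one. -/
def qCoeff (f : ℍ → ℂ) : ℤ → ℂ := Classical.epsilon (HasQExpansion f)

lemma HasFourierExpansion.add {f g : ℍ → ℂ} {c d : ℚ → ℂ} (hf : HasFourierExpansion f c)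
    (hg : HasFourierExpansion g d) : HasFourierExpansion (f + g) (c + d) := by
  obtain ⟨⟨B, hB⟩, hf⟩ := hf
  obtain ⟨⟨C, hC⟩, hg⟩ := hg
  refine ⟨⟨min B C, fun n hn => ?_⟩, fun τ => ?_⟩
  · simp [hB n (lt_of_lt_of_le hn (min_le_left _ _)), hC n (lt_of_lt_of_le hn (min_le_right _ _))]
  · simpa [add_mul] using (hf τ).add (hg τ)

lemma HasFourierExpansion.smul {f : ℍ → ℂ} {c : ℚ → ℂ} (a : ℂ) (hf : HasFourierExpansion f c) :
    HasFourierExpansion (a • f) (a • c) := by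
  obtain ⟨⟨B, hB⟩, hf⟩ := hf
  refine ⟨⟨B, fun n hn => by simp [hB n hn]⟩, fun τ => ?_⟩
  simpa [mul_assoc] using (hf τ).mul_left a

lemma HasFourierExpansion.zero : HasFourierExpansion 0 0 :=
  ⟨⟨0, fun _ _ => rfl⟩, fun τ => by simp⟩

lemma MeromorphicAtInfty.add {f g : ℍ → ℂ} (hf : MeromorphicAtInfty f)
    (hg : MeromorphicAtInfty g) : MeromorphicAtInfty (f + g) := by
  obtain ⟨h, hh, c, hc, hf⟩ := hf
  obtain ⟨h', hh', d, hd, hg⟩ := hg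
  refine ⟨h * h', Nat.mul_pos hh hh', c + d, fun n hn => ?_, hf.add hg⟩
  by_cases h0 : c n = 0
  · have h1 : d n ≠ 0 := fun h1 => hn (by simp [h0, h1])
    obtain ⟨m, hm⟩ := hd n h1
    exact ⟨h * m, by push_cast; rw [mul_assoc, hm]⟩
  · obtain ⟨m, hm⟩ := hc n h0
    exact ⟨h' * m, by push_cast; rw [mul_comm (h : ℚ), mul_assoc, hm]⟩

lemma MeromorphicAtInfty.smul {f : ℍ → ℂ} (a : ℂ) (hf : MeromorphicAtInfty f) :
    MeromorphicAtInfty (a • f) := by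
  obtain ⟨h, hh, c, hc, hf⟩ := hf
  exact ⟨h, hh, a • c, fun n hn => hc n fun h0 => hn (by simp [h0]), hf.smul a⟩

lemma MeromorphicAtInfty.zero : MeromorphicAtInfty 0 :=
  ⟨1, one_pos, 0, fun _ hn => absurd rfl hn, HasFourierExpansion.zero⟩

lemma HasQExpansion.add {f g : ℍ → ℂ} {c d : ℤ → ℂ} (hf : HasQExpansion f c)
    (hg : HasQExpansion g d) : HasQExpansion (f + g) (c + d) := by
  obtain ⟨⟨B, hB⟩, hf⟩ := hf
  obtain ⟨⟨C, hC⟩, hg⟩ := hg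
  refine ⟨⟨min B C, fun n hn => ?_⟩, fun τ => ?_⟩
  · simp [hB n (lt_of_lt_of_le hn (min_le_left _ _)), hC n (lt_of_lt_of_le hn (min_le_right _ _))]
  · simpa [add_mul] using (hf τ).add (hg τ)

lemma HasQExpansion.smul {f : ℍ → ℂ} {c : ℤ → ℂ} (a : ℂ) (hf : HasQExpansion f c) :
    HasQExpansion (a • f) (a • c) := by
  obtain ⟨⟨B, hB⟩, hf⟩ := hf
  refine ⟨⟨B, fun n hn => by simp [hB n hn]⟩, fun τ => ?_⟩
  simpa [mul_assoc] using (hf τ).mul_left a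

lemma HasQExpansion.zero : HasQExpansion 0 0 :=
  ⟨⟨0, fun _ _ => rfl⟩, fun τ => by simp⟩

lemma HasQExpansion.eq_zero {d : ℤ → ℂ} (h : HasQExpansion 0 d) : d = 0 := by
  obtain ⟨⟨B, hB⟩, hs⟩ := h
  suffices H : ∀ m : ℕ, ∀ n < B + m, d n = 0 by
    funext n
    exact H (n - B + 1).toNat n (by omega)
  intro m
  induction m with
  | zero => intro n hn; exact hB n (by simpa using hn)
  | succ m ih =>
    intro n hn
    rcases lt_or_eq_of_le (show n ≤ B + m by push_cast at hn; omega) with h1 | h1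
    · exact ih n h1
    rw [h1]
    set M : ℤ := B + m with hM
    let z : ℕ → ℍ := fun t => ⟨(((t : ℝ) + 1 : ℝ) : ℂ) * Complex.I, by simp; positivity⟩
    let F : ℕ → ℤ → ℂ := fun t n => d n * qpow n (z t) * qpow (-M : ℤ) (z t)
    have hF : ∀ t, HasSum (F t) 0 := fun t => by
      have h2 := (hs (z t)).mul_right (qpow (-M : ℤ) (z t))
      rw [Pi.zero_apply, zero_mul] at h2
      exact h2
    have hFn : ∀ t n, ‖F t n‖ = ‖d n‖ * Real.exp (-(2 * Real.pi * (n - M) * (t + 1))) := by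
      intro t n
      have : F t n = d n *
          Complex.exp ((-(2 * Real.pi * (n - M) * (t + 1)) : ℝ) : ℂ) := by
        simp only [F, qpow, z, mul_assoc, ← Complex.exp_add]
        congr 2
        push_cast
        linear_combination (2 * Real.pi * (n - M) * ((t : ℂ) + 1)) * Complex.I_sq
      rw [this, norm_mul, ← Complex.ofReal_exp, Complex.norm_real, Real.norm_eq_abs, Real.abs_exp]
    have hFM : ∀ t, F t M = d M := by
      intro t
      simp only [F, qpow, mul_assoc, ← Complex.exp_add]
      have : 2 * (Real.pi : ℂ) * Complex.I * ((M : ℚ) : ℂ) * (z t : ℂ)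
          + 2 * Real.pi * Complex.I * (((-M : ℤ) : ℚ) : ℂ) * (z t : ℂ) = 0 := by
        push_cast; ring
      simp only [mul_assoc] at this
      rw [this]; simp
    have hlim : Filter.Tendsto (fun t => ∑' n, F t n) Filter.atTop
        (nhds (∑' n, if n = M then d M else 0)) := by
      refine tendsto_tsum_of_dominated_convergence (bound := fun n => ‖F 0 n‖)
        (hF 0).summable.norm (fun n => ?_) (Filter.Eventually.of_forall fun t n => ?_)
      · rcases lt_trichotomy n M with h2 | h2 | h2
        · simp [F, ih n h2, h2.ne]
        · subst h2; simp only [hFM, if_true]; exact tendsto_const_nhds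
        · rw [if_neg h2.ne', tendsto_zero_iff_norm_tendsto_zero]
          simp only [hFn]
          rw [← mul_zero ‖d n‖]
          refine Filter.Tendsto.const_mul _ (Real.tendsto_exp_neg_atTop_nhds_zero.comp ?_)
          have h3 : (0 : ℝ) < 2 * Real.pi * (n - M) := by
            have : (0 : ℝ) < (n : ℝ) - M := by rw [sub_pos]; exact_mod_cast h2
            positivity
          exact Filter.Tendsto.const_mul_atTop h3
            (Filter.tendsto_atTop_add_const_right _ _ tendsto_natCast_atTop_atTop)
      · rcases lt_or_ge n M with h2 | h2
        · simp [F, ih n h2]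
        · rw [hFn, hFn]
          refine mul_le_mul_of_nonneg_left (Real.exp_le_exp.2 (neg_le_neg ?_)) (norm_nonneg _)
          have h3 : (0 : ℝ) ≤ 2 * Real.pi * (n - M) := by
            have : (0 : ℝ) ≤ (n : ℝ) - M := by rw [sub_nonneg]; exact_mod_cast h2
            positivity
          refine mul_le_mul_of_nonneg_left ?_ h3
          push_cast
          linarith [Nat.cast_nonneg (α := ℝ) t]
    simp only [(hF _).tsum_eq, tsum_ite_eq] at hlim
    exact (tendsto_nhds_unique hlim tendsto_const_nhds)

lemma HasQExpansion.unique {f : ℍ → ℂ} {c d : ℤ → ℂ} (hc : HasQExpansion f c)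
    (hd : HasQExpansion f d) : c = d := by
  have h := hc.add (hd.smul (-1))
  have h0 : f + (-1 : ℂ) • f = 0 := by simp
  rw [h0] at h
  have := h.eq_zero
  simpa [← sub_eq_add_neg, sub_eq_zero] using this

lemma HasQExpansion.qCoeff_eq {f : ℍ → ℂ} {c : ℤ → ℂ} (hc : HasQExpansion f c) : qCoeff f = c :=
  (Classical.epsilon_spec (p := HasQExpansion f) ⟨c, hc⟩).unique hc

/-! ### Vector-valued modular forms -/

section VectorValued

variable {A : Type*} [AddCommGroup A] [Fintype A] [DecidableEq A]

/-- The space `A_k(ρ*)` of weakly holomorphic modular forms of integral weight `k` for `ρ*`. For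
`x = (M, √(cτ+d)) ∈ Mp₂(ℤ)` the factor `(cτ+d)^k` is the `2k`-th power of the square root. -/
def weakForms (Q : QuadraticMap ℤ A (AddCircle (1 : ℚ))) (k : ℤ) : Submodule ℂ (ℍ → A → ℂ) where
  carrier := {F |
    (∀ γ, MDifferentiable 𝓘(ℂ) 𝓘(ℂ) fun τ => F τ γ) ∧
    (∀ x ∈ dualWeilGraph Q, ∀ τ : ℍ, F (x.1.mat • τ) = x.1.root τ ^ (2 * k) • x.2 (F τ)) ∧
    ∀ γ, ∃ c : ℚ → ℂ, (∀ n, c n ≠ 0 → ((n : ℚ) : AddCircle (1 : ℚ)) = -(Q γ)) ∧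
      HasFourierExpansion (fun τ => F τ γ) c}
  add_mem' := by
    rintro F G ⟨h1, h2, h3⟩ ⟨h1', h2', h3'⟩
    refine ⟨fun γ => (h1 γ).add (h1' γ), fun x hx τ => ?_, fun γ => ?_⟩
    · simp only [Pi.add_apply, h2 x hx τ, h2' x hx τ, map_add, smul_add]
    · obtain ⟨c, hc, hf⟩ := h3 γ
      obtain ⟨d, hd, hg⟩ := h3' γ
      refine ⟨c + d, fun n hn => ?_, hf.add hg⟩
      by_cases h0 : c n = 0
      · exact hd n fun h1 => hn (by simp [h0, h1])
      · exact hc n h0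
  zero_mem' := by
    refine ⟨fun γ => mdifferentiable_const, fun x hx τ => by simp, fun γ => ?_⟩
    exact ⟨0, fun n hn => absurd rfl hn, HasFourierExpansion.zero⟩
  smul_mem' := by
    rintro a F ⟨h1, h2, h3⟩
    refine ⟨fun γ => (h1 γ).const_smul a, fun x hx τ => ?_, fun γ => ?_⟩
    · simp only [Pi.smul_apply, h2 x hx τ, map_smul]
      rw [smul_comm]
    · obtain ⟨c, hc, hf⟩ := h3 γ
      exact ⟨a • c, fun n hn => hc n fun h0 => hn (by simp [h0]), hf.smul a⟩

end VectorValued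

/-! ### Scalar-valued modular forms -/

/-- The space `A_k(N, ξ)` of weakly holomorphic modular forms of weight `k` for `Γ₀(N)` with
character `ξ`: holomorphic on `ℍ`, meromorphic at all cusps. -/
def scalarForms (N : ℕ) (k : ℤ) (ξ : DirichletCharacter ℂ N) : Submodule ℂ (ℍ → ℂ) where
  carrier := {G |
    MDifferentiable 𝓘(ℂ) 𝓘(ℂ) G ∧
    (∀ M ∈ CongruenceSubgroup.Gamma0 N, ∀ τ : ℍ,
      G (M • τ) = ξ ((M 1 1 : ℤ) : ZMod N) * denom M τ ^ k * G τ) ∧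
    ∀ M : SL(2, ℤ), MeromorphicAtInfty (G ∣[k] M)}
  add_mem' := by
    rintro F G ⟨h1, h2, h3⟩ ⟨h1', h2', h3'⟩
    refine ⟨h1.add h1', fun M hM τ => ?_, fun M => ?_⟩
    · simp only [Pi.add_apply, h2 M hM τ, h2' M hM τ, mul_add]
    · rw [SlashAction.add_slash]
      exact (h3 M).add (h3' M)
  zero_mem' := by
    refine ⟨mdifferentiable_const, fun M hM τ => by simp, fun M => ?_⟩
    rw [SlashAction.zero_slash]
    exact MeromorphicAtInfty.zero
  smul_mem' := by
    rintro a F ⟨h1, h2, h3⟩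
    refine ⟨h1.const_smul a, fun M hM τ => ?_, fun M => ?_⟩
    · simp only [Pi.smul_apply, h2 M hM τ, smul_eq_mul]
      ring
    · rw [ModularForm.SL_smul_slash]
      exact (h3 M).smul a

/-- Multiplication by a positive real number on the upper half-plane. -/
def dilate (r : ℝ) (hr : 0 < r) (τ : ℍ) : ℍ :=
  ⟨(r : ℂ) * τ, by simpa using mul_pos hr τ.im_pos⟩

/-- The point `-1/(Nτ)` of the upper half-plane. -/
def frickePoint (N : ℕ) [NeZero N] (τ : ℍ) : ℍ :=
  ⟨-1 / ((N : ℂ) * τ), by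
    have hN : (0 : ℝ) < N := by exact_mod_cast Nat.pos_of_ne_zero (NeZero.ne N)
    have h := UpperHalfPlane.im_inv_neg_coe_pos (dilate N hN τ)
    have e : -1 / ((N : ℂ) * τ) = (-(dilate N hN τ : ℂ))⁻¹ := by
      simp [dilate, neg_div, inv_neg]
    rw [e]; exact h⟩

section Components

variable {A : Type*} [AddCommGroup A] {p : ℕ}

/-- The component `G_γ = ½ ∑_{n ∈ p(ℤ - Q(γ))} c(n) q^n` of `G = ∑ c(n) q^n`. -/
def component (Q : QuadraticMap ℤ A (AddCircle (1 : ℚ))) (p : ℕ) (G : ℍ → ℂ) (γ : A) (τ : ℍ) : ℂ :=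
  1 / 2 * ∑' n : {n : ℤ // (((n : ℚ) / p : ℚ) : AddCircle (1 : ℚ)) = -(Q γ)},
    qCoeff G n * qpow (n : ℤ) τ

lemma component_add (Q : QuadraticMap ℤ A (AddCircle (1 : ℚ))) {F G : ℍ → ℂ} {c d : ℤ → ℂ}
    (hF : HasQExpansion F c) (hG : HasQExpansion G d) (γ : A) (τ : ℍ) :
    component Q p (F + G) γ τ = component Q p F γ τ + component Q p G γ τ := by
  have h1 := (hF.2 τ).summable.subtype
    {n : ℤ | (((n : ℚ) / p : ℚ) : AddCircle (1 : ℚ)) = -(Q γ)}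
  have h2 := (hG.2 τ).summable.subtype
    {n : ℤ | (((n : ℚ) / p : ℚ) : AddCircle (1 : ℚ)) = -(Q γ)}
  have h3 := h1.tsum_add h2
  simp only [component, (hF.add hG).qCoeff_eq, hF.qCoeff_eq, hG.qCoeff_eq, Pi.add_apply, add_mul]
  rw [← mul_add]
  congr 1

lemma component_smul (Q : QuadraticMap ℤ A (AddCircle (1 : ℚ))) {F : ℍ → ℂ} {c : ℤ → ℂ}
    (hF : HasQExpansion F c) (a : ℂ) (γ : A) (τ : ℍ) :
    component Q p (a • F) γ τ = a * component Q p F γ τ := by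
  simp only [component, (hF.smul a).qCoeff_eq, hF.qCoeff_eq, Pi.smul_apply, smul_eq_mul, mul_assoc,
    tsum_mul_left]
  ring

lemma component_zero (Q : QuadraticMap ℤ A (AddCircle (1 : ℚ))) (γ : A) (τ : ℍ) :
    component Q p 0 γ τ = 0 := by
  simp [component, HasQExpansion.zero.qCoeff_eq]

end Components

section PrimeLevel

variable {p : ℕ} [Fact p.Prime]

lemma p_pos : (0 : ℝ) < p := by exact_mod_cast (Fact.out : p.Prime).pos

/-- The quadratic character `χ_p = (·/p)`. -/
def chiP (p : ℕ) [Fact p.Prime] : DirichletCharacter ℂ p :=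
  (quadraticChar (ZMod p)).ringHomComp (Int.castRingHom ℂ)

/-- The slash operator of `W_{p²} = (0, -1; p², 0)`, normalized by `det^{k/2}`:
`(G|_k W_{p²})(τ) = p^k (p²τ)^{-k} G(-1/(p²τ))`. -/
def fricke (p : ℕ) [Fact p.Prime] (k : ℤ) (G : ℍ → ℂ) (τ : ℍ) : ℂ :=
  (p : ℂ) ^ k * ((p : ℂ) ^ 2 * τ) ^ (-k) * G (frickePoint (p ^ 2) τ)

variable {A : Type*} [AddCommGroup A] [Fintype A] [DecidableEq A]

/-- The component-wise twist `G_ψ = ∑_{γ ≠ 0} ψ(γ) G_γ`, with `A` identified with `ℤ/pℤ`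
through `e`. -/
def twist (Q : QuadraticMap ℤ A (AddCircle (1 : ℚ))) (e : A ≃+ ZMod p)
    (ψ : DirichletCharacter ℂ p) (G : ℍ → ℂ) (τ : ℍ) : ℂ :=
  ∑ γ ∈ Finset.univ.erase (0 : A), ψ (e γ) * component Q p G γ τ

/-- The `ε`-condition: `G = ∑_{n ≫ -∞} c(n) q^n` with `c(n) = 0` unless `n ∈ p(ℤ - Q(γ))` for some
`γ ≠ 0`. -/
def EpsCondition (Q : QuadraticMap ℤ A (AddCircle (1 : ℚ))) (p : ℕ) (G : ℍ → ℂ) : Prop :=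
  ∃ c : ℤ → ℂ, HasQExpansion G c ∧
    ∀ n, c n ≠ 0 → ∃ γ : A, γ ≠ 0 ∧ (((n : ℚ) / p : ℚ) : AddCircle (1 : ℚ)) = -(Q γ)

/-- The Atkin-Lehner condition: for all `ψ ≠ χ̄` mod `p`,
`G_ψ|_k W_{p²} = conj(ψχ(2α)) g(ψχ)/√p · 𝐞(sig/8) · G_{ψ̄ χ̄²}`. The inverse of a Dirichlet character
is its complex conjugate. -/
def AtkinLehnerCondition (Q : QuadraticMap ℤ A (AddCircle (1 : ℚ))) (e : A ≃+ ZMod p) (α : ℤ)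
    (k : ℤ) (χ : DirichletCharacter ℂ p) (G : ℍ → ℂ) : Prop :=
  ∀ ψ : DirichletCharacter ℂ p, ψ ≠ χ⁻¹ → ∀ τ : ℍ,
    fricke p k (twist Q e ψ G) τ
      = conj ((ψ * χ) ((2 * α : ℤ) : ZMod p))
        * (gaussSum (ψ * χ) (ZMod.stdAddChar (N := p)) / ((Real.sqrt p : ℝ) : ℂ))
        * eSig8 Q * twist Q e (ψ⁻¹ * χ⁻¹ ^ 2) G τ

lemma twist_add (Q : QuadraticMap ℤ A (AddCircle (1 : ℚ))) (e : A ≃+ ZMod p) {F G : ℍ → ℂ}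
    {c d : ℤ → ℂ} (hF : HasQExpansion F c) (hG : HasQExpansion G d)
    (ψ : DirichletCharacter ℂ p) (τ : ℍ) :
    twist Q e ψ (F + G) τ = twist Q e ψ F τ + twist Q e ψ G τ := by
  simp only [twist, component_add Q hF hG, mul_add, Finset.sum_add_distrib]

lemma twist_smul (Q : QuadraticMap ℤ A (AddCircle (1 : ℚ))) (e : A ≃+ ZMod p) {F : ℍ → ℂ}
    {c : ℤ → ℂ} (hF : HasQExpansion F c) (a : ℂ) (ψ : DirichletCharacter ℂ p) (τ : ℍ) :
    twist Q e ψ (a • F) τ = a * twist Q e ψ F τ := by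
  simp only [twist, component_smul Q hF, Finset.mul_sum, mul_left_comm]

/-- The space `A_k^{ε,AL}(p², χ ⊗ χ_p)` of forms in `A_k(p², χ ⊗ χ_p)` satisfying the `ε`-condition
and the Atkin-Lehner condition. -/
def epsALForms (Q : QuadraticMap ℤ A (AddCircle (1 : ℚ))) (e : A ≃+ ZMod p) (α : ℤ) (k : ℤ)
    (χ : DirichletCharacter ℂ p) : Submodule ℂ (ℍ → ℂ) where
  carrier := {G |
    G ∈ scalarForms (p ^ 2) k (DirichletCharacter.changeLevel (dvd_pow_self p two_ne_zero)
      (χ * chiP p)) ∧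
    EpsCondition Q p G ∧ AtkinLehnerCondition Q e α k χ G}
  add_mem' := by
    rintro F G ⟨h1, ⟨c, hc, hc'⟩, h3⟩ ⟨h1', ⟨d, hd, hd'⟩, h3'⟩
    refine ⟨add_mem h1 h1', ⟨c + d, hc.add hd, fun n hn => ?_⟩, fun ψ hψ τ => ?_⟩
    · by_cases h0 : c n = 0
      · exact hd' n fun h1 => hn (by simp [h0, h1])
      · exact hc' n h0
    · have h := h3 ψ hψ τ
      have h' := h3' ψ hψ τ
      simp only [fricke] at h h' ⊢
      rw [twist_add Q e hc hd, twist_add Q e hc hd, mul_add, h, h', mul_add]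
  zero_mem' := by
    refine ⟨zero_mem _, ⟨0, HasQExpansion.zero, fun n hn => absurd rfl hn⟩, fun ψ hψ τ => ?_⟩
    simp [fricke, twist, component_zero]
  smul_mem' := by
    rintro a F ⟨h1, ⟨c, hc, hc'⟩, h3⟩
    refine ⟨Submodule.smul_mem _ a h1, ⟨a • c, hc.smul a, fun n hn =>
      hc' n fun h0 => hn (by simp [h0])⟩, fun ψ hψ τ => ?_⟩
    have h := h3 ψ hψ τ
    simp only [fricke] at h ⊢
    rw [twist_smul Q e hc, twist_smul Q e hc, mul_left_comm, h]
    ring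

/-- The twisted component sum `φ_χ(F)(τ) = ∑_{γ ≠ 0} χ(γ) F_γ(pτ)`. -/
def twistedComponentSum (e : A ≃+ ZMod p) (χ : DirichletCharacter ℂ p) (F : ℍ → A → ℂ) :
    ℍ → ℂ := fun τ =>
  ∑ γ ∈ Finset.univ.erase (0 : A), χ (e γ) * F (dilate p p_pos τ) γ

/-- `G₀ = √p/(p-1) · 𝐞(-sig/8) · G_{χ̄}|_k W_{p²} + 1/(p-1) · G_{χ̄}`. -/
def zeroComponent (Q : QuadraticMap ℤ A (AddCircle (1 : ℚ))) (e : A ≃+ ZMod p) (k : ℤ)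
    (χ : DirichletCharacter ℂ p) (G : ℍ → ℂ) (τ : ℍ) : ℂ :=
  ((Real.sqrt p : ℝ) : ℂ) / ((p : ℂ) - 1) * (eSig8 Q)⁻¹ * fricke p k (twist Q e χ⁻¹ G) τ
    + 1 / ((p : ℂ) - 1) * twist Q e χ⁻¹ G τ

/-- The map `G ↦ ∑_{γ ≠ 0} conj(χ(γ)) G_γ(τ/p) 𝔢_γ + G₀(τ/p) 𝔢_0`. -/
def reconstruct (Q : QuadraticMap ℤ A (AddCircle (1 : ℚ))) (e : A ≃+ ZMod p) (k : ℤ)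
    (χ : DirichletCharacter ℂ p) (G : ℍ → ℂ) : ℍ → A → ℂ := fun τ γ =>
  if γ = 0 then zeroComponent Q e k χ G (dilate (p : ℝ)⁻¹ (inv_pos.2 p_pos) τ)
  else conj (χ (e γ)) * component Q p G γ (dilate (p : ℝ)⁻¹ (inv_pos.2 p_pos) τ)

end PrimeLevel

end TwistedSum

end

open TwistedSum

/-!
Write `f_x` for the component of `F` at `e⁻¹(x)`, `x ∈ ℤ/p`, and `ζ(t) = 𝐞(t/p)`. Membership of `F`
in `A_k(ρ*)` means that every `f_x` is holomorphic with exponents in `ℤ - Q(x)`, that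
`f_x|T = ζ(-αx²) f_x`, and that `f_x|S = 𝐞(sig/8) p^{-1/2} ∑_y ζ(2αxy) f_y` (`mem_weakForms_iff`).

*From vectors to scalars.* The quadratic Gauss sum `∑_y ζ(αuy²) = χ_p(u) √p 𝐞(sig/8)` shows that the
action of `S` and `T` extends to an explicit matrix `weilCoeff` for every element of `SL₂(ℤ)`,
depending only on its residue mod `p` (`slash_eq_sum_weilCoeff`). On `Γ₀(p) ∩ Γ⁰(p)` it permutes the
components up to `χ_p`, which is the `Γ₀(p²)`-modularity of `∑_x χ(x) f_x(pτ)`; for `-1` it gives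
`f_{-x} = χ(-1) f_x`. As the exponents of `f_x` and `f_y` are disjoint mod `1` unless `y = ±x`, the
`x`-component of `φ_χ(F)` is `χ(x) f_x(pτ)` (`component_twistedComponentSum`). After the substitution
`τ ↦ pτ` the operator `W_{p²}` is the slash action of `S` (`fricke_comp_dilate`), so the
Atkin–Lehner condition is the `S`-transformation law summed against the characters `ψχ ≠ 1`, and the
formula for `G₀` is the same law summed against the trivial character.

*From scalars to vectors.* Reading this backwards, orthogonality of characters recovers the
`S`-transformation of the components with `x ≠ 0`; for `x = 0` it follows from `S² = -1` and
`𝐞(sig/4) = (-1)^{sig/2}` (`coord_reconstruct_slash_S`). The components with `x ≠ 0` transform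
correctly under `T` by their exponents, and what remains is the periodicity of `f₀`. If `χ` is odd,
then `f₀ = 0`. If `χ` is even, the relation `STS = T⁻¹ST⁻¹` compares the two defects `D = f₀|T - f₀`
and `D' = f₀ - f₀|T⁻¹` and yields `D|S = -ζ(αx²) D'` for all `x ≠ 0`; for `p ≥ 5` the form takes two
different nonzero values, so `D' = 0` (`zero_component_slash_T`). The only case left out is `p = 3`
with `χ` even, that is, `χ = 1`. The modularity of `G` under `Γ₀(p²)` is not needed in this
direction, only its meromorphy at the cusps, which passes to `f₀` because every rational matrix of
positive determinant is an element of `SL₂(ℤ)` times an upper triangular one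
(`MeromorphicAtCusps.slash_rat`).
-/

namespace TwistedSum

/-! ### Gauss sums attached to the quadratic form -/

section GaussSums

lemma sqrt_p_sq {p : ℕ} : ((Real.sqrt p : ℝ) : ℂ) ^ 2 = p := by
  rw [← Complex.ofReal_pow, Real.sq_sqrt (Nat.cast_nonneg p), Complex.ofReal_natCast]

variable {p : ℕ} [Fact p.Prime]

lemma zmod_two_ne_zero (hp : p ≠ 2) : (2 : ZMod p) ≠ 0 := by
  intro h
  have h1 : ((2 : ℕ) : ZMod p) = 0 := by exact_mod_cast h
  rw [ZMod.natCast_eq_zero_iff] at h1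
  exact hp ((Nat.prime_dvd_prime_iff_eq Fact.out Nat.prime_two).1 h1)

lemma chiP_apply (u : ZMod p) : chiP p u = ((quadraticChar (ZMod p) u : ℤ) : ℂ) := rfl

lemma chiP_mul_self {u : ZMod p} (hu : u ≠ 0) : chiP p u * chiP p u = 1 := by
  rw [chiP_apply, ← Int.cast_mul, ← sq, quadraticChar_sq_one hu, Int.cast_one]

lemma chiP_inv (u : ZMod p) : chiP p u⁻¹ = chiP p u := by
  rcases eq_or_ne u 0 with rfl | hu
  · simp
  · have h : chiP p u⁻¹ * chiP p u = 1 := by rw [← map_mul, inv_mul_cancel₀ hu, map_one]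
    calc chiP p u⁻¹ = chiP p u⁻¹ * (chiP p u * chiP p u) := by rw [chiP_mul_self hu, mul_one]
      _ = chiP p u := by rw [← mul_assoc, h, one_mul]

lemma chiP_isQuadratic : (chiP p).IsQuadratic :=
  (quadraticChar_isQuadratic (ZMod p)).comp _

lemma chiP_ne_one (hp : p ≠ 2) : chiP p ≠ 1 := by
  have h2 : ringChar (ZMod p) ≠ 2 := by rwa [ZMod.ringChar_zmod_n]
  obtain ⟨u, hu⟩ := quadraticChar_exists_neg_one h2
  intro h
  have h0 : u ≠ 0 := fun h0 => by rw [h0, quadraticChar_zero] at hu; norm_num at hu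
  have h1 := congrArg (fun ψ : DirichletCharacter ℂ p => ψ u) h
  simp only [chiP_apply, hu] at h1
  rw [MulChar.one_apply (isUnit_iff_ne_zero.2 h0)] at h1
  norm_num at h1

lemma sum_stdAddChar_mul {b : ZMod p} :
    ∑ y : ZMod p, ZMod.stdAddChar (b * y) = if b = 0 then (p : ℂ) else 0 := by
  have h := AddChar.sum_mulShift b (ZMod.isPrimitive_stdAddChar p)
  rw [ZMod.card] at h
  simp only [mul_comm b]
  rw [h]
  split_ifs <;> simp

/-- Counting square roots turns the quadratic Gauss sum into the Gauss sum of `χ_p`. -/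
lemma sum_stdAddChar_mul_sq (hp : p ≠ 2) {u : ZMod p} (hu : u ≠ 0) :
    ∑ y : ZMod p, ZMod.stdAddChar (u * y ^ 2)
      = chiP p u * gaussSum (chiP p) (ZMod.stdAddChar (N := p)) := by
  have h2 : ringChar (ZMod p) ≠ 2 := by rwa [ZMod.ringChar_zmod_n]
  have h1 : ∑ y : ZMod p, ZMod.stdAddChar (u * y ^ 2)
      = ∑ t : ZMod p, (chiP p t + 1) * ZMod.stdAddChar (u * t) := by
    rw [← Finset.sum_fiberwise (s := Finset.univ) (g := fun y : ZMod p => y ^ 2)]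
    refine Finset.sum_congr rfl fun t _ => ?_
    have h3 := quadraticChar_card_sqrts h2 t
    have h4 : ∀ y ∈ Finset.univ.filter (fun y : ZMod p => y ^ 2 = t),
        ZMod.stdAddChar (u * y ^ 2) = ZMod.stdAddChar (u * t) := fun y hy => by
      rw [(Finset.mem_filter.1 hy).2]
    rw [Finset.sum_congr rfl h4, Finset.sum_const, nsmul_eq_mul]
    congr 1
    have h5 : {x : ZMod p | x ^ 2 = t}.toFinset
        = Finset.univ.filter (fun y : ZMod p => y ^ 2 = t) := by ext; simp
    rw [h5] at h3
    rw [chiP_apply]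
    exact_mod_cast congrArg (Int.cast : ℤ → ℂ) h3
  rw [h1]
  simp only [add_mul, one_mul, Finset.sum_add_distrib, sum_stdAddChar_mul, if_neg hu, add_zero]
  have h6 := gaussSum_mulShift_eq (chiP p) (ZMod.stdAddChar (N := p)) (Units.mk0 u hu)
  simp only [gaussSum, AddChar.mulShift_apply, Units.val_mk0] at h6
  rw [h6, chiP_isQuadratic.inv, gaussSum]

lemma stdAddChar_complete_square {u : ZMod p} (hu : u ≠ 0) (v : ZMod p) :
    ∑ y : ZMod p, ZMod.stdAddChar (u * y ^ 2 + 2 * v * y)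
      = ZMod.stdAddChar (-(v ^ 2 / u)) * ∑ y : ZMod p, ZMod.stdAddChar (u * y ^ 2) := by
  rw [Finset.mul_sum, ← Equiv.sum_comp (Equiv.addRight (v / u)) fun y : ZMod p =>
    (ZMod.stdAddChar (-(v ^ 2 / u)) * ZMod.stdAddChar (u * y ^ 2) : ℂ)]
  refine Finset.sum_congr rfl fun y _ => ?_
  rw [← AddChar.map_add_eq_mul, Equiv.coe_addRight]
  congr 1
  field_simp
  ring

variable {a : ZMod p} {s : ℂ}

lemma sqrt_p_ne_zero : ((Real.sqrt p : ℝ) : ℂ) ≠ 0 := by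
  have := p_pos (p := p)
  exact_mod_cast (Real.sqrt_pos.2 this).ne'

lemma gauss_mul (hp : p ≠ 2) (ha : a ≠ 0)
    (hs : ∑ y : ZMod p, ZMod.stdAddChar (a * y ^ 2) = (Real.sqrt p : ℝ) * s)
    {u : ZMod p} (hu : u ≠ 0) :
    ∑ y : ZMod p, ZMod.stdAddChar (u * a * y ^ 2) = chiP p u * ((Real.sqrt p : ℝ) * s) := by
  rw [← hs, sum_stdAddChar_mul_sq hp (mul_ne_zero hu ha), sum_stdAddChar_mul_sq hp ha, map_mul,
    mul_assoc]

lemma gauss_sq (hp : p ≠ 2) (ha : a ≠ 0)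
    (hs : ∑ y : ZMod p, ZMod.stdAddChar (a * y ^ 2) = (Real.sqrt p : ℝ) * s) :
    s ^ 2 = chiP p (-1) := by
  have h0 : gaussSum (chiP p) (ZMod.stdAddChar (N := p)) ^ 2
      = chiP p (-1) * (Fintype.card (ZMod p) : ℂ) :=
    gaussSum_sq (chiP_ne_one hp) chiP_isQuadratic (ZMod.isPrimitive_stdAddChar p)
  have h1 : (((Real.sqrt p : ℝ) : ℂ) * s) ^ 2 = chiP p (-1) * p := by
    rw [← hs, sum_stdAddChar_mul_sq hp ha, mul_pow, sq (chiP p a), chiP_mul_self ha, one_mul,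
      h0, ZMod.card]
  rw [mul_pow, sqrt_p_sq, mul_comm] at h1
  exact mul_right_cancel₀ (by exact_mod_cast (Fact.out : p.Prime).ne_zero) h1

end GaussSums

/-! ### The quadratic form in coordinates -/

lemma eQZ_add (x y : AddCircle (1 : ℚ)) : eQZ (x + y) = eQZ x * eQZ y := by
  induction x using QuotientAddGroup.induction_on with | H x =>
  induction y using QuotientAddGroup.induction_on with | H y =>
  change eQZ ((x + y : ℚ) : AddCircle (1 : ℚ)) = eQZ (x : AddCircle (1 : ℚ)) * eQZ (y : AddCircle (1 : ℚ))
  simp only [eQZ_coe, ← Complex.exp_add]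
  congr 1
  push_cast
  ring

lemma eQZ_zero : eQZ 0 = 1 := by
  have := eQZ_coe 0
  simpa using this

lemma eQZ_neg (x : AddCircle (1 : ℚ)) : eQZ (-x) = (eQZ x)⁻¹ := by
  refine eq_inv_of_mul_eq_one_left ?_
  rw [← eQZ_add, neg_add_cancel, eQZ_zero]

section Coordinates

variable {p : ℕ} [Fact p.Prime]

lemma eQZ_div (n : ℤ) :
    eQZ (((n : ℚ) / p : ℚ) : AddCircle (1 : ℚ)) = ZMod.stdAddChar (n : ZMod p) := by
  rw [eQZ_coe, ZMod.stdAddChar_coe]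
  congr 1
  push_cast
  ring

lemma coe_div_eq_iff (m n : ℤ) :
    (((m : ℚ) / p : ℚ) : AddCircle (1 : ℚ)) = (((n : ℚ) / p : ℚ) : AddCircle (1 : ℚ))
      ↔ (m : ZMod p) = n := by
  have hp : (p : ℚ) ≠ 0 := by exact_mod_cast (Fact.out : p.Prime).ne_zero
  rw [← sub_eq_zero, ← AddCircle.coe_sub, AddCircle.coe_eq_zero_iff, ← sub_eq_zero (a := (m : ZMod p)),
    ← Int.cast_sub, ZMod.intCast_zmod_eq_zero_iff_dvd]
  constructor
  · rintro ⟨t, ht⟩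
    refine ⟨t, ?_⟩
    field_simp at ht
    simp only [zsmul_eq_mul, mul_one] at ht
    have : ((m - n : ℤ) : ℚ) = ((p * t : ℤ) : ℚ) := by push_cast; linarith
    exact_mod_cast this
  · rintro ⟨t, ht⟩
    refine ⟨t, ?_⟩
    have : ((m - n : ℤ) : ℚ) = ((p * t : ℤ) : ℚ) := by rw [ht]
    push_cast at this
    field_simp
    simp only [zsmul_eq_mul, mul_one]
    linarith

variable {A : Type*} [AddCommGroup A] {Q : QuadraticMap ℤ A (AddCircle (1 : ℚ))}
  {e : A ≃+ ZMod p} {α : ℤ}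

/-- The classes `p(ℤ - Q(γ))` of exponents are residue classes mod `p`. -/
lemma coe_div_eq_neg_Q_iff
    (hα : ∀ n : ℤ, Q (e.symm (n : ZMod p)) = ((α * n ^ 2 / p : ℚ) : AddCircle (1 : ℚ)))
    (n : ℤ) (x : ZMod p) :
    (((n : ℚ) / p : ℚ) : AddCircle (1 : ℚ)) = -(Q (e.symm x))
      ↔ (n : ZMod p) = -((α : ZMod p) * x ^ 2) := by
  have hx : ((x.val : ℤ) : ZMod p) = x := by simp
  have h : -(Q (e.symm x))
      = ((((-(α * (x.val : ℤ) ^ 2) : ℤ) : ℚ) / p : ℚ) : AddCircle (1 : ℚ)) := by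
    have := hα x.val
    rw [hx] at this
    rw [this, ← AddCircle.coe_neg]
    congr 1
    push_cast
    ring
  rw [h, coe_div_eq_iff]
  push_cast
  simp

lemma eQZ_Q (hα : ∀ n : ℤ, Q (e.symm (n : ZMod p)) = ((α * n ^ 2 / p : ℚ) : AddCircle (1 : ℚ)))
    (x : ZMod p) : eQZ (Q (e.symm x)) = ZMod.stdAddChar ((α : ZMod p) * x ^ 2) := by
  have hx : ((x.val : ℤ) : ZMod p) = x := by simp
  have h := hα x.val
  rw [hx] at h
  have h2 := eQZ_div (p := p) (α * (x.val : ℤ) ^ 2)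
  push_cast at h2 hx
  push_cast at h
  rw [h, h2]
  simp

lemma eQZ_polar
    (hα : ∀ n : ℤ, Q (e.symm (n : ZMod p)) = ((α * n ^ 2 / p : ℚ) : AddCircle (1 : ℚ)))
    (x y : ZMod p) : eQZ (QuadraticMap.polar Q (e.symm x) (e.symm y))
      = ZMod.stdAddChar (2 * (α : ZMod p) * x * y) := by
  rw [QuadraticMap.polar, ← map_add, sub_eq_add_neg, sub_eq_add_neg, eQZ_add, eQZ_add, eQZ_neg,
    eQZ_neg, eQZ_Q hα, eQZ_Q hα, eQZ_Q hα, ← AddChar.map_neg_eq_inv, ← AddChar.map_neg_eq_inv,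
    ← AddChar.map_add_eq_mul, ← AddChar.map_add_eq_mul]
  congr 1
  ring

lemma alpha_ne_zero (hQ : IsNondegenerate Q)
    (hα : ∀ n : ℤ, Q (e.symm (n : ZMod p)) = ((α * n ^ 2 / p : ℚ) : AddCircle (1 : ℚ))) :
    (α : ZMod p) ≠ 0 := by
  intro h0
  have hQ0 : ∀ x : ZMod p, Q (e.symm x) = 0 := fun x => by
    have h := (coe_div_eq_neg_Q_iff hα 0 x).2 (by simp [h0])
    simpa using h.symm
  have h1 : e.symm 1 = 0 := hQ _ fun β => by
    obtain ⟨y, rfl⟩ := e.symm.surjective β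
    rw [QuadraticMap.polar, ← map_add, hQ0, hQ0, hQ0]
    simp
  rw [map_eq_zero_iff _ e.symm.injective] at h1
  exact one_ne_zero h1

variable [Fintype A]

/-- The signature exists because the normalized Gauss sum squares to `χ_p(-1) = ±1`, hence is an
eighth root of unity. -/
lemma gauss_eq_eSig8 (hp : p ≠ 2) (hQ : IsNondegenerate Q)
    (hα : ∀ n : ℤ, Q (e.symm (n : ZMod p)) = ((α * n ^ 2 / p : ℚ) : AddCircle (1 : ℚ))) :
    ∑ y : ZMod p, ZMod.stdAddChar ((α : ZMod p) * y ^ 2) = (Real.sqrt p : ℝ) * eSig8 Q := by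
  have ha := alpha_ne_zero hQ hα
  have hcard : Fintype.card A = p := by rw [Fintype.card_congr e.toEquiv, ZMod.card]
  have hsum : ∑ γ : A, eQZ (Q γ) = ∑ y : ZMod p, ZMod.stdAddChar ((α : ZMod p) * y ^ 2) := by
    rw [← e.symm.toEquiv.sum_comp]
    exact Finset.sum_congr rfl fun y _ => eQZ_Q hα y
  set g : ℂ := ((Real.sqrt p : ℝ) : ℂ)⁻¹ * ∑ y : ZMod p, ZMod.stdAddChar ((α : ZMod p) * y ^ 2)
    with hg
  have hs : ∑ y : ZMod p, ZMod.stdAddChar ((α : ZMod p) * y ^ 2) = (Real.sqrt p : ℝ) * g := by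
    rw [hg, mul_inv_cancel_left₀ sqrt_p_ne_zero]
  have hg8 : g ^ 8 = 1 := by
    have h1 := gauss_sq hp ha hs
    have h2 : g ^ 4 = 1 := by
      rw [show g ^ 4 = g ^ 2 * g ^ 2 by ring, h1, chiP_mul_self (neg_ne_zero.2 one_ne_zero)]
    rw [show g ^ 8 = g ^ 4 * g ^ 4 by ring, h2, one_mul]
  obtain ⟨i, hi, hgi⟩ := (Complex.isPrimitiveRoot_exp 8 (by norm_num)).eq_pow_of_pow_eq_one hg8
  have hex : ∃ t : ZMod 8, Complex.exp (2 * Real.pi * Complex.I * ((t.val : ℂ) / 8))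
      = ((Real.sqrt (Fintype.card A) : ℝ) : ℂ)⁻¹ * ∑ γ : A, eQZ (Q γ) := by
    refine ⟨(i : ZMod 8), ?_⟩
    rw [hcard, hsum, ← hg, ← hgi, ZMod.val_cast_of_lt hi, ← Complex.exp_nat_mul]
    congr 1
    push_cast
    ring
  have h3 := Classical.epsilon_spec hex
  change eSig8 Q = _ at h3
  rw [hcard, hsum, ← hg] at h3
  rw [h3, hs]

/-- The signature is even, because `𝐞(sig/8)` is a fourth root of unity; so the integer division in
`halfSig` is exact. -/
lemma eSig8_sq_eq (hp : p ≠ 2) (hQ : IsNondegenerate Q)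
    (hα : ∀ n : ℤ, Q (e.symm (n : ZMod p)) = ((α * n ^ 2 / p : ℚ) : AddCircle (1 : ℚ))) :
    eSig8 Q ^ 2 = (-1) ^ halfSig Q := by
  have h1 := gauss_sq hp (alpha_ne_zero hQ hα) (gauss_eq_eSig8 hp hQ hα)
  have h4 : eSig8 Q ^ 4 = 1 := by
    rw [show eSig8 Q ^ 4 = eSig8 Q ^ 2 * eSig8 Q ^ 2 by ring, h1,
      chiP_mul_self (neg_ne_zero.2 one_ne_zero)]
  have h5 : ∀ j : ℕ, eSig8 Q ^ j
      = Complex.exp (Real.pi * Complex.I * ((j * (signature Q).val : ℕ) / 4)) := fun j => by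
    rw [eSig8, ← Complex.exp_nat_mul]
    congr 1
    push_cast
    ring
  have hpi : ∀ m : ℕ, Complex.exp (Real.pi * Complex.I * m) = (-1) ^ m := fun m => by
    rw [mul_comm, Complex.exp_nat_mul, Complex.exp_pi_mul_I]
  have heven : Even (signature Q).val := by
    have h6 := h5 4
    rw [h4] at h6
    have h7 : (-1 : ℂ) ^ (signature Q).val = 1 := by
      rw [← hpi, h6]
      congr 2
      push_cast
      ring
    exact (neg_one_pow_eq_one_iff_even (by norm_num)).1 h7
  obtain ⟨m, hm⟩ := heven
  have h8 : halfSig Q = (m : ℤ) := by rw [halfSig, hm]; push_cast; omega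
  rw [h8, zpow_natCast, ← hpi, h5, hm]
  congr 2
  push_cast
  ring

end Coordinates

/-! ### The Weil representation on all of `SL₂(ℤ)` -/

section WeilMatrix

variable {p : ℕ} [Fact p.Prime]

/-- The `(x, y)` entry of the matrix by which `(A, B; C, D) ∈ SL₂(𝔽_p)` acts in the dual Weil
representation of `ℤ/p` with the form `a x² / p`, where `s = 𝐞(sig/8)`. -/
noncomputable def weilCoeff (a : ZMod p) (s : ℂ) (A B C D x y : ZMod p) : ℂ :=
  if C = 0 then (if y = A * x then chiP p D * ZMod.stdAddChar (-(a * A * B * x ^ 2)) else 0)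
  else s / (Real.sqrt p : ℝ) * chiP p C *
    ZMod.stdAddChar (-(a * (A * x ^ 2 - 2 * x * y + D * y ^ 2) / C))

variable {a : ZMod p} {s : ℂ}

lemma weilCoeff_T_mul {A B C D : ZMod p} (hdet : A * D - B * C = 1) (x y : ZMod p) :
    weilCoeff a s (A + C) (B + D) C D x y
      = ZMod.stdAddChar (-(a * x ^ 2)) * weilCoeff a s A B C D x y := by
  unfold weilCoeff
  by_cases hC : C = 0
  · subst hC
    simp only [if_true, add_zero]
    split_ifs
    · rw [mul_left_comm, ← AddChar.map_add_eq_mul]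
      congr 2
      linear_combination (-a * x ^ 2) * hdet
    · simp
  · simp only [if_neg hC]
    rw [mul_left_comm, ← AddChar.map_add_eq_mul]
    congr 2
    field_simp
    ring

/-- Left multiplication by `S` sends `(A, B; C, D)` to `(-C, -D; A, B)`. The sum over `y` is a single
term if `C = 0`, a full character sum if `A = 0`, and a quadratic Gauss sum otherwise. -/
lemma weilCoeff_S_mul (hp : p ≠ 2) (ha : a ≠ 0)
    (hs : ∑ y : ZMod p, ZMod.stdAddChar (a * y ^ 2) = (Real.sqrt p : ℝ) * s)
    {A B C D : ZMod p} (hdet : A * D - B * C = 1) (x z : ZMod p) :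
    weilCoeff a s (-C) (-D) A B x z
      = ∑ y : ZMod p, s / (Real.sqrt p : ℝ) * ZMod.stdAddChar (2 * a * x * y)
          * weilCoeff a s A B C D y z := by
  have h2 : (2 : ZMod p) ≠ 0 := zmod_two_ne_zero hp
  have hsq := gauss_sq hp ha hs
  have hr := sqrt_p_ne_zero (p := p)
  have hr2 := sqrt_p_sq (p := p)
  have hneg : chiP p (-1) * chiP p (-1) = 1 := chiP_mul_self (neg_ne_zero.2 one_ne_zero)
  set r : ℂ := ((Real.sqrt p : ℝ) : ℂ) with hrdef
  unfold weilCoeff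
  by_cases hC : C = 0
  · subst hC
    have hAD : A * D = 1 := by simpa using hdet
    have hA : A ≠ 0 := left_ne_zero_of_mul_eq_one hAD
    have hD : D = A⁻¹ := eq_inv_of_mul_eq_one_right hAD
    rw [if_neg hA]
    simp only [if_true]
    rw [Finset.sum_eq_single (D * z)]
    · rw [if_pos (by rw [← mul_assoc, hAD, one_mul]), hD, chiP_inv]
      rw [mul_mul_mul_comm, ← AddChar.map_add_eq_mul]
      congr 2
      field_simp
      ring
    · intro y _ hy
      rw [if_neg, mul_zero]
      rintro rfl
      exact hy (by rw [← mul_assoc, mul_comm D, hAD, one_mul])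
    · simp
  · by_cases hA : A = 0
    · subst hA
      have hBC : B * C = -1 := by linear_combination -hdet
      have hB : B = -C⁻¹ := by
        field_simp
        exact hBC
      simp only [if_neg hC, if_true]
      have h3 : ∀ y : ZMod p, s / r * ZMod.stdAddChar (2 * a * x * y) *
          (s / r * chiP p C *
            ZMod.stdAddChar (-(a * (0 * y ^ 2 - 2 * y * z + D * z ^ 2) / C)))
          = (s / r) ^ 2 * chiP p C * ZMod.stdAddChar (-(a * D * z ^ 2 / C)) *
            ZMod.stdAddChar ((2 * a * (x + z / C)) * y) := fun y => by
        have : (ZMod.stdAddChar (2 * a * x * y) : ℂ) *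
            ZMod.stdAddChar (-(a * (0 * y ^ 2 - 2 * y * z + D * z ^ 2) / C))
            = ZMod.stdAddChar (-(a * D * z ^ 2 / C)) *
              ZMod.stdAddChar ((2 * a * (x + z / C)) * y) := by
          rw [← AddChar.map_add_eq_mul, ← AddChar.map_add_eq_mul]
          congr 1
          field_simp
          ring
        linear_combination ((s / r) ^ 2 * chiP p C) * this
      rw [Finset.sum_congr rfl fun y _ => h3 y, ← Finset.mul_sum, sum_stdAddChar_mul]
      have h4 : 2 * a * (x + z / C) = 0 ↔ z = -C * x := by
        rw [mul_eq_zero, or_iff_right (mul_ne_zero h2 ha)]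
        constructor
        · intro h
          field_simp at h
          linear_combination h
        · rintro rfl
          field_simp
          ring
      by_cases hz : z = -C * x
      · rw [if_pos (h4.2 hz), if_pos hz, hB, ← neg_one_mul C⁻¹, map_mul, chiP_inv, ← hr2, div_pow,
          hsq, hz]
        have : (ZMod.stdAddChar (-(a * -C * -D * x ^ 2)) : ℂ)
            = ZMod.stdAddChar (-(a * D * (-C * x) ^ 2 / C)) := by
          congr 1
          field_simp
        rw [this]
        field_simp
      · rw [if_neg (mt h4.1 hz), if_neg hz, mul_zero]
    · simp only [if_neg hC, if_neg hA]
      have hu : -A / C ≠ 0 := div_ne_zero (neg_ne_zero.2 hA) hC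
      have h3 : ∀ y : ZMod p, s / r * ZMod.stdAddChar (2 * a * x * y) *
          (s / r * chiP p C *
            ZMod.stdAddChar (-(a * (A * y ^ 2 - 2 * y * z + D * z ^ 2) / C)))
          = (s / r) ^ 2 * chiP p C * ZMod.stdAddChar (-(a * D * z ^ 2 / C)) *
            ZMod.stdAddChar ((-A / C) * a * y ^ 2 + 2 * (a * (x + z / C)) * y) := fun y => by
        have : (ZMod.stdAddChar (2 * a * x * y) : ℂ) *
            ZMod.stdAddChar (-(a * (A * y ^ 2 - 2 * y * z + D * z ^ 2) / C))
            = ZMod.stdAddChar (-(a * D * z ^ 2 / C)) *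
              ZMod.stdAddChar ((-A / C) * a * y ^ 2 + 2 * (a * (x + z / C)) * y) := by
          rw [← AddChar.map_add_eq_mul, ← AddChar.map_add_eq_mul]
          congr 1
          field_simp
          ring
        linear_combination ((s / r) ^ 2 * chiP p C) * this
      rw [Finset.sum_congr rfl fun y _ => h3 y, ← Finset.mul_sum,
        stdAddChar_complete_square (mul_ne_zero hu ha), gauss_mul hp ha hs hu]
      have h5 : (ZMod.stdAddChar (-(a * (-C * x ^ 2 - 2 * x * z + B * z ^ 2) / A)) : ℂ)
          = ZMod.stdAddChar (-(a * D * z ^ 2 / C)) *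
            ZMod.stdAddChar (-((a * (x + z / C)) ^ 2 / (-A / C * a))) := by
        rw [← AddChar.map_add_eq_mul]
        congr 1
        field_simp
        linear_combination (z ^ 2) * hdet
      have h6 : chiP p (-A / C) = chiP p (-1) * chiP p A * chiP p C := by
        rw [show -A / C = -1 * A * C⁻¹ by field_simp, map_mul, map_mul, chiP_inv]
      have h7 : chiP p C * chiP p C = 1 := chiP_mul_self hC
      have h8 : chiP p C * chiP p C * (chiP p (-1) * chiP p (-1)) = 1 := by rw [h7, hneg, one_mul]
      rw [h5, h6, div_pow, hsq, ← hrdef]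
      generalize (ZMod.stdAddChar (-(a * D * z ^ 2 / C)) : ℂ) = E₁
      generalize (ZMod.stdAddChar (-((a * (x + z / C)) ^ 2 / (-A / C * a))) : ℂ) = E₂
      field_simp
      linear_combination (-(s * chiP p A * E₁ * E₂)) * h8

lemma weilCoeff_one (x y : ZMod p) : weilCoeff a s 1 0 0 1 x y = if y = x then 1 else 0 := by
  simp [weilCoeff]

variable {k : ℤ} {f : ZMod p → ℍ → ℂ}

/-- The entries `weilCoeff` define the weight `k` action of all of `SL₂(ℤ)` as soon as `S` and `T`
act as in the dual Weil representation. -/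
theorem slash_eq_sum_weilCoeff (hp : p ≠ 2) (ha : a ≠ 0)
    (hs : ∑ y : ZMod p, ZMod.stdAddChar (a * y ^ 2) = (Real.sqrt p : ℝ) * s)
    (hT : ∀ x, f x ∣[k] ModularGroup.T = (ZMod.stdAddChar (-(a * x ^ 2)) : ℂ) • f x)
    (hS : ∀ x, f x ∣[k] ModularGroup.S
      = ∑ y, (s / (Real.sqrt p : ℝ) * ZMod.stdAddChar (2 * a * x * y)) • f y)
    (M : SL(2, ℤ)) (x : ZMod p) :
    f x ∣[k] M = ∑ y, weilCoeff a s (M 0 0 : ℤ) (M 0 1 : ℤ) (M 1 0 : ℤ) (M 1 1 : ℤ) x y • f y := by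
  have hdet : ∀ M : SL(2, ℤ), ((M 0 0 : ℤ) : ZMod p) * (M 1 1 : ℤ)
      - ((M 0 1 : ℤ) : ZMod p) * (M 1 0 : ℤ) = 1 := fun M => by
    have := M.det_coe
    rw [Matrix.det_fin_two] at this
    exact_mod_cast congrArg (Int.cast : ℤ → ZMod p) this
  let P : SL(2, ℤ) → Prop := fun M => ∀ x, f x ∣[k] M
    = ∑ y, weilCoeff a s (M 0 0 : ℤ) (M 0 1 : ℤ) (M 1 0 : ℤ) (M 1 1 : ℤ) x y • f y
  have hTe : ∀ M : SL(2, ℤ), ∀ x y, weilCoeff a s ((ModularGroup.T * M) 0 0 : ℤ)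
      ((ModularGroup.T * M) 0 1 : ℤ) ((ModularGroup.T * M) 1 0 : ℤ) ((ModularGroup.T * M) 1 1 : ℤ) x y
      = ZMod.stdAddChar (-(a * x ^ 2))
        * weilCoeff a s (M 0 0 : ℤ) (M 0 1 : ℤ) (M 1 0 : ℤ) (M 1 1 : ℤ) x y := fun M x y => by
    rw [← weilCoeff_T_mul (hdet M)]
    simp [ModularGroup.coe_T, Matrix.mul_apply, Fin.sum_univ_two]
  have stepS : ∀ M, P M → P (ModularGroup.S * M) := by
    intro M hM x
    rw [SlashAction.slash_mul, hS, SlashAction.sum_slash]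
    simp only [ModularForm.SL_smul_slash, hM _, Finset.smul_sum, smul_smul]
    rw [Finset.sum_comm]
    refine Finset.sum_congr rfl fun z _ => ?_
    rw [← Finset.sum_smul, ← weilCoeff_S_mul hp ha hs (hdet M)]
    simp [ModularGroup.coe_S, Matrix.mul_apply, Fin.sum_univ_two]
  have stepT : ∀ M, P M → P (ModularGroup.T * M) := by
    intro M hM x
    rw [SlashAction.slash_mul, hT, ModularForm.SL_smul_slash, hM x, Finset.smul_sum]
    simp only [hTe, smul_smul]
  have hTi : ∀ x, f x ∣[k] ModularGroup.T⁻¹ = (ZMod.stdAddChar (a * x ^ 2) : ℂ) • f x := fun x => by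
    have h1 := congrArg (fun g : ℍ → ℂ => g ∣[k] ModularGroup.T⁻¹) (hT x)
    simp only [← SlashAction.slash_mul, mul_inv_cancel, SlashAction.slash_one,
      ModularForm.SL_smul_slash] at h1
    rw [h1, smul_smul, ← AddChar.map_add_eq_mul, h1.symm]
    simp
  have key : P M := by
    have hM : M ∈ Subgroup.closure {ModularGroup.S, ModularGroup.T} := by
      simp [SpecialLinearGroup.SL2Z_generators]
    induction hM using Subgroup.closure_induction_left with
    | one =>
      intro x
      simp [weilCoeff_one]
    | mul_left g hg M _ ih =>
      rcases hg with rfl | rfl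
      · exact stepS M ih
      · exact stepT M ih
    | inv_mul_cancel g hg M _ ih =>
      rcases hg with rfl | rfl
      · -- `S⁻¹ = S³`
        have : ModularGroup.S⁻¹ * M = ModularGroup.S * (ModularGroup.S * (ModularGroup.S * M)) := by
          rw [inv_mul_eq_iff_eq_mul]
          simp only [← mul_assoc]
          have h4 : ModularGroup.S * ModularGroup.S * ModularGroup.S * ModularGroup.S = 1 := by
            decide +kernel
          rw [h4, one_mul]
        rw [this]
        exact stepS _ (stepS _ (stepS _ ih))
      · intro x
        rw [SlashAction.slash_mul, hTi, ModularForm.SL_smul_slash, ih x, Finset.smul_sum]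
        refine Finset.sum_congr rfl fun y _ => ?_
        -- the rule for `T`, applied to `T⁻¹M`, is the rule for `T⁻¹`
        have h1 := hTe (ModularGroup.T⁻¹ * M) x y
        rw [mul_inv_cancel_left] at h1
        rw [smul_smul, h1, ← mul_assoc, ← AddChar.map_add_eq_mul]
        simp
  exact key x

end WeilMatrix

/-! ### Vector-valued forms in coordinates -/

lemma denom_T_eq (τ : ℍ) : denom ((ModularGroup.T : SL(2, ℤ)) : GL (Fin 2) ℝ) τ = 1 := by
  rw [ModularGroup.denom_apply]; simp [ModularGroup.T]

lemma slash_T_apply (k : ℤ) (f : ℍ → ℂ) (τ : ℍ) :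
    (f ∣[k] ModularGroup.T) τ = f (ModularGroup.T • τ) := by
  rw [ModularForm.SL_slash_apply, denom_T_eq, one_zpow, mul_one]

lemma slash_S_apply (k : ℤ) (f : ℍ → ℂ) (τ : ℍ) :
    (f ∣[k] ModularGroup.S) τ = f (ModularGroup.S • τ) * (τ : ℂ) ^ (-k) := by
  rw [ModularForm.SL_slash_apply, ModularGroup.denom_S]

section WeakForms

variable {A : Type*} [AddCommGroup A] [Fintype A] [DecidableEq A]
  {Q : QuadraticMap ℤ A (AddCircle (1 : ℚ))} {k : ℤ} {F : ℍ → A → ℂ}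

/-- Equivariance under `Mp₂(ℤ)` only has to be tested on the two generators. -/
lemma dualWeilGraph_equivariant_iff :
    (∀ x ∈ dualWeilGraph Q, ∀ τ : ℍ, F (x.1.mat • τ) = x.1.root τ ^ (2 * k) • x.2 (F τ)) ↔
      (∀ τ : ℍ, F (ModularGroup.S • τ) = (τ : ℂ) ^ k • rhoS Q (F τ)) ∧
      ∀ τ : ℍ, F (ModularGroup.T • τ) = rhoT Q (F τ) := by
  have hroot : ∀ τ : ℍ, Mp2Z.genS.root τ ^ (2 * k) = (τ : ℂ) ^ k := fun τ => by
    rw [zpow_mul, zpow_ofNat, Mp2Z.genS.sq]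
    exact congrArg (· ^ k) (ModularGroup.denom_S τ)
  constructor
  · intro h
    refine ⟨fun τ => ?_, fun τ => ?_⟩
    · rw [← hroot]
      exact h (Mp2Z.genS, rhoS Q) (Submonoid.subset_closure (by simp)) τ
    · have := h (Mp2Z.genT, rhoT Q) (Submonoid.subset_closure (by simp)) τ
      simpa [Mp2Z.genT] using this
  · rintro ⟨hS, hT⟩ x hx
    induction hx using Submonoid.closure_induction with
    | mem x hx =>
      intro τ
      rcases hx with rfl | rfl
      · rw [hroot]
        exact hS τ
      · simpa [Mp2Z.genT] using hT τ
    | one => intro τ; simp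
    | mul x y _ _ ihx ihy =>
      intro τ
      have h1 : (x * y).1.mat • τ = x.1.mat • y.1.mat • τ := SemigroupAction.mul_smul _ _ _
      rw [h1, ihx, ihy, Prod.fst_mul, Prod.snd_mul, Mp2Z.mul_root, map_smul, Module.End.mul_apply,
        smul_smul, mul_zpow]

variable {p : ℕ} [Fact p.Prime] {e : A ≃+ ZMod p} {α : ℤ}

/-- The components of a vector-valued function, indexed by `ℤ/p` through `e`. -/
def coord (e : A ≃+ ZMod p) (F : ℍ → A → ℂ) (x : ZMod p) (τ : ℍ) : ℂ := F τ (e.symm x)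

lemma mem_weakForms_iff
    (hα : ∀ n : ℤ, Q (e.symm (n : ZMod p)) = ((α * n ^ 2 / p : ℚ) : AddCircle (1 : ℚ))) :
    F ∈ weakForms Q k ↔
      (∀ x, MDifferentiable 𝓘(ℂ) 𝓘(ℂ) (coord e F x)) ∧
      (∀ x, coord e F x ∣[k] ModularGroup.T
        = (ZMod.stdAddChar (-((α : ZMod p) * x ^ 2)) : ℂ) • coord e F x) ∧
      (∀ x, coord e F x ∣[k] ModularGroup.S = ∑ y, (eSig8 Q / (Real.sqrt p : ℝ) *
        ZMod.stdAddChar (2 * (α : ZMod p) * x * y)) • coord e F y) ∧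
      ∀ x, ∃ c : ℚ → ℂ, (∀ n, c n ≠ 0 → ((n : ℚ) : AddCircle (1 : ℚ)) = -(Q (e.symm x))) ∧
        HasFourierExpansion (coord e F x) c := by
  have hcard : Fintype.card A = p := by rw [Fintype.card_congr e.toEquiv, ZMod.card]
  have hrS : ∀ (τ : ℍ) (x : ZMod p), rhoS Q (F τ) (e.symm x) = ∑ y, eSig8 Q / (Real.sqrt p : ℝ) *
        ZMod.stdAddChar (2 * (α : ZMod p) * x * y) * F τ (e.symm y) := fun τ x => by
    rw [rhoS, Matrix.toLin'_apply, Matrix.mulVec, dotProduct, ← Equiv.sum_comp e.symm.toEquiv]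
    refine Finset.sum_congr rfl fun y _ => ?_
    simp [eQZ_polar hα, hcard]
  have hrT : ∀ (τ : ℍ) (x : ZMod p), rhoT Q (F τ) (e.symm x)
      = ZMod.stdAddChar (-((α : ZMod p) * x ^ 2)) * F τ (e.symm x) := fun τ x => by
    rw [rhoT, Matrix.toLin'_apply, Matrix.mulVec_diagonal, eQZ_neg, eQZ_Q hα,
      AddChar.map_neg_eq_inv]
  change (_ ∧ (∀ x ∈ dualWeilGraph Q, _) ∧ _) ↔ _
  rw [dualWeilGraph_equivariant_iff, e.symm.surjective.forall (p := fun γ =>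
    MDifferentiable 𝓘(ℂ) 𝓘(ℂ) fun τ => F τ γ), e.symm.surjective.forall (p := fun γ => ∃ c : ℚ → ℂ,
      (∀ n, c n ≠ 0 → ((n : ℚ) : AddCircle (1 : ℚ)) = -(Q γ)) ∧
      HasFourierExpansion (fun τ => F τ γ) c)]
  refine and_congr Iff.rfl ?_
  rw [and_assoc, and_left_comm]
  refine and_congr ?_ (and_congr ?_ Iff.rfl)
  · constructor
    · intro h x
      funext τ
      rw [slash_T_apply, Pi.smul_apply, smul_eq_mul, coord, h τ, hrT, coord]
    · intro h τ
      funext γ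
      obtain ⟨x, rfl⟩ := e.symm.surjective γ
      have := congrFun (h x) τ
      rw [slash_T_apply, Pi.smul_apply, smul_eq_mul, coord, coord] at this
      rw [this, hrT]
  · constructor
    · intro h x
      funext τ
      rw [slash_S_apply, coord, h τ, Pi.smul_apply, hrS, smul_eq_mul, mul_comm, ← mul_assoc,
        ← zpow_add₀ τ.ne_zero, neg_add_cancel, zpow_zero, one_mul]
      simp [coord]
    · intro h τ
      funext γ
      obtain ⟨x, rfl⟩ := e.symm.surjective γ
      have := congrFun (h x) τ
      rw [slash_S_apply, coord, zpow_neg, ← div_eq_mul_inv,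
        div_eq_iff (zpow_ne_zero _ τ.ne_zero)] at this
      rw [this, Pi.smul_apply, hrS, smul_eq_mul, mul_comm]
      simp [coord]

end WeakForms

section Symmetry

variable {p : ℕ} [Fact p.Prime] {a : ZMod p} {s : ℂ} {k : ℤ} {f : ZMod p → ℍ → ℂ}

/-- The action of `-1 ∈ SL₂(ℤ)` gives the parity of the components. -/
lemma apply_neg_of_weil (hp : p ≠ 2) (ha : a ≠ 0)
    (hs : ∑ y : ZMod p, ZMod.stdAddChar (a * y ^ 2) = (Real.sqrt p : ℝ) * s)
    (hT : ∀ x, f x ∣[k] ModularGroup.T = (ZMod.stdAddChar (-(a * x ^ 2)) : ℂ) • f x)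
    (hS : ∀ x, f x ∣[k] ModularGroup.S
      = ∑ y, (s / (Real.sqrt p : ℝ) * ZMod.stdAddChar (2 * a * x * y)) • f y) (x : ZMod p) (τ : ℍ) :
    f (-x) τ = (-1) ^ k * s ^ 2 * f x τ := by
  have h := congrFun (slash_eq_sum_weilCoeff hp ha hs hT hS (-1) (-x)) τ
  rw [ModularForm.SL_slash_apply] at h
  have hd : denom ((-1 : SL(2, ℤ)) : GL (Fin 2) ℝ) τ = -1 := by
    rw [ModularGroup.denom_apply]; simp
  rw [hd, ModularGroup.SL_neg_smul, one_smul] at h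
  simp only [Matrix.SpecialLinearGroup.coe_neg, Matrix.SpecialLinearGroup.coe_one, Matrix.neg_apply,
    Matrix.one_apply_eq, weilCoeff] at h
  simp only [Int.cast_neg, Int.cast_one, ne_eq, Fin.isValue, zero_ne_one, not_false_eq_true,
    one_ne_zero, Matrix.one_apply_ne, neg_zero, Int.cast_zero, if_true, mul_zero, zero_mul,
    AddChar.map_zero_eq_one, mul_one, neg_mul_neg, one_mul, ite_smul, zero_smul,
    Finset.sum_ite_eq', Finset.mem_univ, Pi.smul_apply, smul_eq_mul] at h
  rw [gauss_sq hp ha hs, mul_assoc, ← h, zpow_neg, mul_comm (f (-x) τ), mul_inv_cancel_left₀]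
  exact zpow_ne_zero _ (by norm_num)

/-- `Γ₀(p) ∩ Γ⁰(p)` permutes the components up to the character `χ_p`. -/
lemma slash_of_dvd (hp : p ≠ 2) (ha : a ≠ 0)
    (hs : ∑ y : ZMod p, ZMod.stdAddChar (a * y ^ 2) = (Real.sqrt p : ℝ) * s)
    (hT : ∀ x, f x ∣[k] ModularGroup.T = (ZMod.stdAddChar (-(a * x ^ 2)) : ℂ) • f x)
    (hS : ∀ x, f x ∣[k] ModularGroup.S
      = ∑ y, (s / (Real.sqrt p : ℝ) * ZMod.stdAddChar (2 * a * x * y)) • f y)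
    {M : SL(2, ℤ)} (hB : ((M 0 1 : ℤ) : ZMod p) = 0) (hC : ((M 1 0 : ℤ) : ZMod p) = 0)
    (x : ZMod p) :
    f x ∣[k] M = chiP p ((M 1 1 : ℤ) : ZMod p) • f ((M 0 0 : ℤ) * x) := by
  rw [slash_eq_sum_weilCoeff hp ha hs hT hS M x]
  simp [weilCoeff, hB, hC]

end Symmetry

/-! ### Fourier expansions under affine substitutions -/

lemma HasFourierExpansion.comp_affine {f : ℍ → ℂ} {c : ℚ → ℂ} (hf : HasFourierExpansion f c)
    {σ : ℍ → ℍ} {r q : ℚ} (hr : 0 < r) (hσ : ∀ τ, (σ τ : ℂ) = r * τ + q) :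
    HasFourierExpansion (f ∘ σ) fun n =>
      c (n / r) * Complex.exp (2 * Real.pi * Complex.I * ((n / r : ℚ) * q : ℚ)) := by
  obtain ⟨⟨B, hB⟩, hs⟩ := hf
  refine ⟨⟨B * r, fun n hn => ?_⟩, fun τ => ?_⟩
  · simp only [hB _ ((div_lt_iff₀ hr).2 hn), zero_mul]
  · rw [← (Equiv.mulRight₀ r hr.ne').hasSum_iff]
    refine (hs (σ τ)).congr_fun ?_
    intro n
    simp only [Function.comp_apply, Equiv.mulRight₀_apply, mul_div_cancel_right₀ _ hr.ne', mul_assoc, qpow,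
      ← Complex.exp_add]
    congr 2
    rw [hσ]
    push_cast
    ring

lemma MeromorphicAtInfty.comp_affine {f : ℍ → ℂ} (hf : MeromorphicAtInfty f)
    {σ : ℍ → ℍ} {r q : ℚ} (hr : 0 < r) (hσ : ∀ τ, (σ τ : ℂ) = r * τ + q) :
    MeromorphicAtInfty (f ∘ σ) := by
  obtain ⟨h, hh, c, hc, hf⟩ := hf
  refine ⟨h * r.den, Nat.mul_pos hh r.pos, _, fun n hn => ?_, hf.comp_affine hr hσ⟩
  obtain ⟨m, hm⟩ := hc _ (left_ne_zero_of_mul hn)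
  refine ⟨m * r.num, ?_⟩
  have h1 : (r.num : ℚ) = r * r.den := (Rat.mul_den_eq_num r).symm
  push_cast
  rw [← hm, h1]
  field_simp

lemma MeromorphicAtInfty.sum {ι : Type*} {s : Finset ι} {f : ι → ℍ → ℂ}
    (hf : ∀ i ∈ s, MeromorphicAtInfty (f i)) : MeromorphicAtInfty (∑ i ∈ s, f i) :=
  Finset.sum_induction f MeromorphicAtInfty (fun _ _ h h' => h.add h') .zero hf

lemma injective_intCast_div {h : ℕ} (hh : 0 < h) :
    Function.Injective fun m : ℤ => (m : ℚ) / h := fun m n hmn => by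
  have : (h : ℚ) ≠ 0 := by exact_mod_cast hh.ne'
  simpa [div_left_inj' this] using hmn

lemma HasFourierExpansion.hasQExpansion {f : ℍ → ℂ} {c : ℚ → ℂ} (hf : HasFourierExpansion f c)
    {h : ℕ} (hh : 0 < h) (hc : ∀ n, c n ≠ 0 → ∃ m : ℤ, (h : ℚ) * n = m) {σ : ℍ → ℍ}
    (hσ : ∀ τ, (σ τ : ℂ) = h * τ) : HasQExpansion (f ∘ σ) fun m => c (m / h) := by
  have hh0 : (0 : ℚ) < h := by exact_mod_cast hh
  obtain ⟨⟨B, hB⟩, hs⟩ := hf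
  refine ⟨⟨⌊B * h⌋, fun n hn => hB _ ?_⟩, fun τ => ?_⟩
  · rw [div_lt_iff₀ hh0]
    exact lt_of_lt_of_le (by exact_mod_cast hn) (Int.floor_le _)
  · have h1 := hs (σ τ)
    rw [← (injective_intCast_div hh).hasSum_iff] at h1
    · refine h1.congr_fun ?_
      intro m
      have h2 : (h : ℂ) ≠ 0 := by exact_mod_cast hh.ne'
      simp only [Function.comp_apply, qpow]
      congr 2
      rw [hσ]
      push_cast
      field_simp
    · intro n hn
      by_contra h0
      obtain ⟨m, hm⟩ := hc n (left_ne_zero_of_mul h0)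
      exact hn ⟨m, by simp only; rw [← hm]; field_simp⟩

lemma HasQExpansion.hasFourierExpansion {f : ℍ → ℂ} {c : ℤ → ℂ} (hf : HasQExpansion f c)
    {h : ℕ} (hh : 0 < h) {σ : ℍ → ℍ} (hσ : ∀ τ, (σ τ : ℂ) = (h : ℂ)⁻¹ * τ) :
    HasFourierExpansion (f ∘ σ) (Function.extend (fun m : ℤ => (m : ℚ) / h) c 0) := by
  have hh0 : (0 : ℚ) < h := by exact_mod_cast hh
  have hinj := injective_intCast_div hh
  obtain ⟨⟨B, hB⟩, hs⟩ := hf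
  refine ⟨⟨B / h, fun n hn => ?_⟩, fun τ => ?_⟩
  · by_cases hm : ∃ m : ℤ, (m : ℚ) / h = n
    · obtain ⟨m, rfl⟩ := hm
      rw [hinj.extend_apply]
      rw [div_lt_div_iff_of_pos_right hh0] at hn
      exact hB m (by exact_mod_cast hn)
    · rw [Function.extend_apply' _ _ _ hm, Pi.zero_apply]
  · rw [← hinj.hasSum_iff]
    · refine (hs (σ τ)).congr_fun ?_
      intro m
      rw [Function.comp_apply, hinj.extend_apply]
      simp only [qpow]
      congr 2
      rw [hσ]
      push_cast
      field_simp
    · intro n hn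
      rw [Function.extend_apply' _ _ _ (by simpa using hn), Pi.zero_apply, zero_mul]

/-- A meromorphic function at `∞` of period one only involves integral powers of `q`. -/
lemma MeromorphicAtInfty.integral_exponents {f : ℍ → ℂ} (hf : MeromorphicAtInfty f)
    (hT : ∀ τ : ℍ, f (ModularGroup.T • τ) = f τ) :
    ∃ c : ℚ → ℂ, (∀ n, c n ≠ 0 → ((n : ℚ) : AddCircle (1 : ℚ)) = 0) ∧ HasFourierExpansion f c := by
  obtain ⟨h, hh, c, hc, hf⟩ := hf
  refine ⟨c, fun n hn => ?_, hf⟩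
  have hh0 : (0 : ℝ) < h := by exact_mod_cast hh
  have h1 := hf.hasQExpansion hh hc (σ := dilate h hh0) fun τ => by simp [dilate]
  have hfT : f ∘ (fun τ : ℍ => ModularGroup.T • τ) = f := funext hT
  have h2 := hf.comp_affine (σ := fun τ : ℍ => ModularGroup.T • τ) (r := 1) (q := 1) one_pos
    fun τ => by rw [modular_T_smul]; simp [add_comm]
  rw [hfT] at h2
  have h3 := h2.hasQExpansion hh (fun n hn => by
    simpa using hc _ (left_ne_zero_of_mul hn)) (σ := dilate h hh0) fun τ => by simp [dilate]
  obtain ⟨m, hm⟩ := hc n hn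
  have h4 := congrFun (h1.unique h3) m
  have hnm : (m : ℚ) / h = n := by rw [← hm]; field_simp
  simp only [hnm, div_one, mul_one] at h4
  have h5 := mul_left_cancel₀ hn ((mul_one _).trans h4)
  obtain ⟨t, ht⟩ := Complex.exp_eq_one_iff.1 h5.symm
  rw [AddCircle.coe_eq_zero_iff]
  refine ⟨t, ?_⟩
  have h6 : (n : ℂ) = t := by
    refine mul_left_cancel₀ Complex.two_pi_I_ne_zero ?_
    rw [ht, mul_comm]
  rw [zsmul_eq_mul, mul_one]
  exact_mod_cast h6.symm

/-! ### Meromorphy at all cusps -/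

/-- `f` is meromorphic at every cusp: all its weight `k` translates under `SL₂(ℤ)` are meromorphic
at `∞`. -/
def MeromorphicAtCusps (k : ℤ) (f : ℍ → ℂ) : Prop :=
  ∀ M : SL(2, ℤ), MeromorphicAtInfty (f ∣[k] M)

section Cusps

variable {k : ℤ} {f g : ℍ → ℂ}

lemma MeromorphicAtCusps.add (hf : MeromorphicAtCusps k f) (hg : MeromorphicAtCusps k g) :
    MeromorphicAtCusps k (f + g) := fun M => by
  rw [SlashAction.add_slash]; exact (hf M).add (hg M)

lemma MeromorphicAtCusps.smul (a : ℂ) (hf : MeromorphicAtCusps k f) :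
    MeromorphicAtCusps k (a • f) := fun M => by
  rw [ModularForm.SL_smul_slash]; exact (hf M).smul a

lemma MeromorphicAtCusps.sum {ι : Type*} {s : Finset ι} {f : ι → ℍ → ℂ}
    (hf : ∀ i ∈ s, MeromorphicAtCusps k (f i)) : MeromorphicAtCusps k (∑ i ∈ s, f i) := fun M => by
  rw [SlashAction.sum_slash]; exact .sum fun i hi => hf i hi M

lemma MeromorphicAtCusps.slash (hf : MeromorphicAtCusps k f) (M : SL(2, ℤ)) :
    MeromorphicAtCusps k (f ∣[k] M) := fun N => by
  rw [← SlashAction.slash_mul]; exact hf _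

lemma MeromorphicAtCusps.meromorphicAtInfty (hf : MeromorphicAtCusps k f) :
    MeromorphicAtInfty f := by
  simpa using hf 1

/-- The embedding of `GL₂(ℚ)` into `GL₂(ℝ)`. -/
noncomputable abbrev ratGL : GL (Fin 2) ℚ →* GL (Fin 2) ℝ :=
  Matrix.GeneralLinearGroup.map (algebraMap ℚ ℝ)

lemma ratGL_det_pos {u : GL (Fin 2) ℚ} (hu : 0 < u.det.val) : 0 < (ratGL u).det.val := by
  rw [Matrix.GeneralLinearGroup.map_det]
  simpa using hu

lemma MeromorphicAtInfty.slash_upper (hf : MeromorphicAtInfty f) {u : GL (Fin 2) ℚ}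
    (hu : 0 < u.det.val) (h0 : u 1 0 = 0) : MeromorphicAtInfty (f ∣[k] ratGL u) := by
  have hdet : 0 < u 0 0 * u 1 1 := by
    simpa [Matrix.det_fin_two, h0] using hu
  have hd : u 1 1 ≠ 0 := right_ne_zero_of_mul hdet.ne'
  have hden : ∀ τ : ℍ, denom (ratGL u) τ = ((u 1 1 : ℚ) : ℂ) := fun τ => by
    simp [denom, h0]
  have hsm : ∀ τ : ℍ, ((ratGL u • τ : ℍ) : ℂ)
      = ((u 0 0 / u 1 1 : ℚ) : ℂ) * τ + ((u 0 1 / u 1 1 : ℚ) : ℂ) := fun τ => by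
    have hd' : ((u 1 1 : ℚ) : ℂ) ≠ 0 := by exact_mod_cast hd
    rw [coe_smul_of_det_pos (ratGL_det_pos hu), hden]
    simp only [num, Matrix.GeneralLinearGroup.map_apply]
    push_cast
    simp only [eq_ratCast, Complex.ofReal_ratCast]
    field_simp
  have hr : 0 < u 0 0 / u 1 1 := by
    have : u 0 0 / u 1 1 = u 0 0 * u 1 1 / (u 1 1) ^ 2 := by field_simp
    rw [this]
    positivity
  have h1 := (hf.comp_affine hr hsm).smul
    (((|(ratGL u).det.val| : ℝ) : ℂ) ^ (k - 1) * ((u 1 1 : ℚ) : ℂ) ^ (-k))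
  convert h1 using 1
  funext τ
  rw [ModularForm.slash_apply, hden, σ, if_pos (ratGL_det_pos hu)]
  simp
  ring

/-- Every rational matrix of positive determinant is an element of `SL₂(ℤ)` times an upper
triangular matrix. -/
lemma MeromorphicAtCusps.slash_rat (hf : MeromorphicAtCusps k f) {u : GL (Fin 2) ℚ}
    (hu : 0 < u.det.val) : MeromorphicAtCusps k (f ∣[k] ratGL u) := by
  have key : ∀ u : GL (Fin 2) ℚ, 0 < u.det.val → MeromorphicAtInfty (f ∣[k] ratGL u) := by
    intro u hu
    obtain ⟨M, hM⟩ := OnePoint.exists_mem_SL2 (K := ℚ) ℤ (u • OnePoint.infty)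
    set v : GL (Fin 2) ℚ := (Matrix.SpecialLinearGroup.mapGL ℚ M)⁻¹ * u with hv
    have huv : u = Matrix.SpecialLinearGroup.mapGL ℚ M * v := by rw [hv, mul_inv_cancel_left]
    have hv0 : v 1 0 = 0 := by
      rw [← OnePoint.smul_infty_eq_self_iff, hv, mul_smul, ← hM, inv_smul_smul]
    have hvd : 0 < v.det.val := by
      rw [huv] at hu
      simpa using hu
    have h1 : ratGL u = Matrix.SpecialLinearGroup.mapGL ℝ M * ratGL v := by
      rw [huv, map_mul]
      congr 1
      exact Matrix.SpecialLinearGroup.map_mapGL (T := ℝ) (S := ℚ) M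
    rw [h1, SlashAction.slash_mul]
    exact (hf M).slash_upper hvd hv0
  intro M
  have h2 : (f ∣[k] ratGL u) ∣[k] M = f ∣[k] ratGL (u * Matrix.SpecialLinearGroup.mapGL ℚ M) := by
    rw [map_mul, SlashAction.slash_mul]
    rfl
  rw [h2]
  exact key _ (by simpa using hu)

lemma MeromorphicAtCusps.comp_affine (hf : MeromorphicAtCusps k f) {σ : ℍ → ℍ} {r q : ℚ}
    (hr : 0 < r) (hσ : ∀ τ, (σ τ : ℂ) = r * τ + q) : MeromorphicAtCusps k (f ∘ σ) := by
  let u : GL (Fin 2) ℚ := Matrix.GeneralLinearGroup.mkOfDetNeZero !![r, q; 0, 1]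
    (by simpa [Matrix.det_fin_two] using hr.ne')
  have hu : u.det.val = r := by
    simp [u, Matrix.GeneralLinearGroup.mkOfDetNeZero, Matrix.det_fin_two]
  have hpos := ratGL_det_pos (u := u) (hu ▸ hr)
  have hden : ∀ τ : ℍ, denom (ratGL u) τ = 1 := fun τ => by
    simp [denom, u, Matrix.GeneralLinearGroup.mkOfDetNeZero]
  have h1 : ∀ τ : ℍ, ratGL u • τ = σ τ := fun τ => by
    apply UpperHalfPlane.ext
    rw [coe_smul_of_det_pos hpos, hden, hσ]
    simp [num, u, Matrix.GeneralLinearGroup.mkOfDetNeZero]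
  have hc : (((|(ratGL u).det.val| : ℝ) : ℂ) ^ (k - 1)) ≠ 0 :=
    zpow_ne_zero _ (by exact_mod_cast (abs_pos.2 hpos.ne').ne')
  have h2 := (hf.slash_rat (u := u) (hu ▸ hr)).smul ((((|(ratGL u).det.val| : ℝ) : ℂ) ^ (k - 1))⁻¹)
  convert h2 using 1
  funext τ
  rw [Pi.smul_apply, ModularForm.slash_apply, hden, h1, UpperHalfPlane.σ, if_pos hpos]
  simp only [ContinuousAlgEquiv.refl_apply, one_zpow, mul_one, smul_eq_mul, Function.comp_apply]
  field_simp

end Cusps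

/-! ### Scaling, the Fricke involution and components -/

section Scaling

variable {p : ℕ} [Fact p.Prime]

lemma coe_dilate (r : ℝ) (hr : 0 < r) (τ : ℍ) : (dilate r hr τ : ℂ) = r * τ := rfl

lemma dilate_dilate_inv (τ : ℍ) :
    dilate p p_pos (dilate (p : ℝ)⁻¹ (inv_pos.2 p_pos) τ) = τ := by
  have hp : (p : ℂ) ≠ 0 := by exact_mod_cast (Fact.out : p.Prime).ne_zero
  apply UpperHalfPlane.ext
  simp only [coe_dilate]
  push_cast
  rw [mul_inv_cancel_left₀ hp]

lemma dilate_inv_dilate (τ : ℍ) :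
    dilate (p : ℝ)⁻¹ (inv_pos.2 p_pos) (dilate p p_pos τ) = τ := by
  have hp : (p : ℂ) ≠ 0 := by exact_mod_cast (Fact.out : p.Prime).ne_zero
  apply UpperHalfPlane.ext
  simp only [coe_dilate]
  push_cast
  rw [inv_mul_cancel_left₀ hp]

lemma dilate_frickePoint (τ : ℍ) :
    dilate p p_pos (frickePoint (p ^ 2) τ) = ModularGroup.S • dilate p p_pos τ := by
  have hp : (p : ℂ) ≠ 0 := by exact_mod_cast (Fact.out : p.Prime).ne_zero
  apply UpperHalfPlane.ext
  rw [modular_S_smul]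
  simp only [coe_dilate, frickePoint]
  have := τ.ne_zero
  push_cast
  field_simp

/-- After rescaling, the Fricke involution of level `p²` is the slash action of `S`. -/
lemma fricke_comp_dilate (k : ℤ) (g : ℍ → ℂ) (τ : ℍ) :
    fricke p k (fun τ => g (dilate p p_pos τ)) τ
      = (g ∣[k] ModularGroup.S) (dilate p p_pos τ) := by
  have hp : (p : ℂ) ≠ 0 := by exact_mod_cast (Fact.out : p.Prime).ne_zero
  rw [slash_S_apply, fricke, dilate_frickePoint, coe_dilate, mul_comm (g _)]
  congr 1
  simp only [zpow_neg, mul_zpow, Complex.ofReal_natCast, ← zpow_natCast, ← zpow_mul]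
  have h1 := zpow_ne_zero k hp
  have h2 := zpow_ne_zero k τ.ne_zero
  rw [mul_comm _ k, zpow_mul]
  push_cast
  rw [zpow_ofNat]
  field_simp

variable {A : Type*} [AddCommGroup A] {Q : QuadraticMap ℤ A (AddCircle (1 : ℚ))}
  {e : A ≃+ ZMod p} {α : ℤ} {G : ℍ → ℂ} {d : ℤ → ℂ}

lemma component_hasQExpansion
    (hα : ∀ n : ℤ, Q (e.symm (n : ZMod p)) = ((α * n ^ 2 / p : ℚ) : AddCircle (1 : ℚ)))
    (hG : HasQExpansion G d) (x : ZMod p) :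
    HasQExpansion (component Q p G (e.symm x))
      fun n => if (n : ZMod p) = -((α : ZMod p) * x ^ 2) then d n / 2 else 0 := by
  classical
  obtain ⟨⟨B, hB⟩, hs⟩ := id hG
  refine ⟨⟨B, fun n hn => by simp [hB n hn]⟩, fun τ => ?_⟩
  have h1 := ((hs τ).summable.subtype
    {n : ℤ | (((n : ℚ) / p : ℚ) : AddCircle (1 : ℚ)) = -(Q (e.symm x))}).hasSum.mul_left (1 / 2)
  have h2 : component Q p G (e.symm x) τ = 1 / 2 * ∑' n : {n : ℤ | (((n : ℚ) / p : ℚ) :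
      AddCircle (1 : ℚ)) = -(Q (e.symm x))}, ((fun n : ℤ => d n * qpow n τ) ∘ (↑)) n := by
    rw [component, hG.qCoeff_eq]
    rfl
  rw [h2, ← hasSum_subtype_iff_of_support_subset
    (s := {n : ℤ | (((n : ℚ) / p : ℚ) : AddCircle (1 : ℚ)) = -(Q (e.symm x))})]
  · refine h1.congr_fun fun n => ?_
    have h3 := (coe_div_eq_neg_Q_iff hα n.1 x).1 n.2
    simp only [Function.comp_apply, if_pos h3]
    ring
  · intro n hn
    by_contra h0
    rw [Set.mem_ofPred_eq, coe_div_eq_neg_Q_iff hα n x] at h0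
    exact hn (by simp only [if_neg h0, zero_mul])

lemma EpsCondition_iff_coord
    (hα : ∀ n : ℤ, Q (e.symm (n : ZMod p)) = ((α * n ^ 2 / p : ℚ) : AddCircle (1 : ℚ))) :
    EpsCondition Q p G ↔ ∃ c : ℤ → ℂ, HasQExpansion G c ∧
      ∀ n, c n ≠ 0 → ∃ x : ZMod p, x ≠ 0 ∧ (n : ZMod p) = -((α : ZMod p) * x ^ 2) := by
  unfold EpsCondition
  refine exists_congr fun c => and_congr Iff.rfl (forall_congr' fun n => imp_congr Iff.rfl ?_)
  rw [e.symm.surjective.exists]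
  simp [coe_div_eq_neg_Q_iff hα]

variable [Fintype A] [DecidableEq A]

lemma sum_erase_zero_eq (e : A ≃+ ZMod p) (ψ : DirichletCharacter ℂ p) (h : A → ℂ) :
    ∑ γ ∈ Finset.univ.erase (0 : A), ψ (e γ) * h γ = ∑ x, ψ x * h (e.symm x) := by
  rw [Finset.sum_erase]
  · rw [← Equiv.sum_comp e.symm.toEquiv]
    simp
  · rw [map_zero, MulChar.map_zero, zero_mul]

lemma twist_eq (Q : QuadraticMap ℤ A (AddCircle (1 : ℚ))) (e : A ≃+ ZMod p)
    (ψ : DirichletCharacter ℂ p) (G : ℍ → ℂ) (τ : ℍ) :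
    twist Q e ψ G τ = ∑ x, ψ x * component Q p G (e.symm x) τ :=
  sum_erase_zero_eq e ψ fun γ => component Q p G γ τ

lemma twistedComponentSum_eq (e : A ≃+ ZMod p) (χ : DirichletCharacter ℂ p) (F : ℍ → A → ℂ)
    (τ : ℍ) :
    twistedComponentSum e χ F τ = ∑ x, χ x * coord e F x (dilate p p_pos τ) :=
  sum_erase_zero_eq e χ fun γ => F (dilate p p_pos τ) γ

end Scaling

section CharacterSums

lemma conj_char {p : ℕ} [NeZero p] (ψ : DirichletCharacter ℂ p) (u : ZMod p) : conj (ψ u) = ψ⁻¹ u :=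
  MulChar.star_apply' ψ u

variable {p : ℕ} [Fact p.Prime]

lemma sum_char_mul_stdAddChar {ψ : DirichletCharacter ℂ p} (hψ : ψ ≠ 1) (u : ZMod p) :
    ∑ x, ψ x * ZMod.stdAddChar (u * x) = ψ⁻¹ u * gaussSum ψ (ZMod.stdAddChar (N := p)) := by
  rcases eq_or_ne u 0 with rfl | hu
  · rw [MulChar.map_zero, zero_mul]
    simpa using MulChar.sum_eq_zero_of_ne_one hψ
  · exact gaussSum_mulShift_eq ψ (ZMod.stdAddChar (N := p)) (Units.mk0 u hu)

lemma sum_one_char_mul (h : ZMod p → ℂ) :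
    ∑ x, (1 : DirichletCharacter ℂ p) x * h x = ∑ x, h x - h 0 := by
  rw [eq_sub_iff_add_eq, ← Finset.sum_erase_add _ _ (Finset.mem_univ (0 : ZMod p)),
    ← Finset.sum_erase_add _ _ (Finset.mem_univ (0 : ZMod p)), MulChar.map_zero, zero_mul, add_zero]
  congr 1
  refine Finset.sum_congr rfl fun x hx => ?_
  rw [MulChar.one_apply (isUnit_iff_ne_zero.2 (Finset.ne_of_mem_erase hx)), one_mul]

lemma sum_one_char_mul_stdAddChar (u : ZMod p) :
    ∑ x, (1 : DirichletCharacter ℂ p) x * ZMod.stdAddChar (u * x)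
      = (if u = 0 then (p : ℂ) else 0) - 1 := by
  rw [sum_one_char_mul, sum_stdAddChar_mul, mul_zero, AddChar.map_zero_eq_one]

end CharacterSums

/-! ### From vector-valued forms to scalar-valued forms -/

section Forward

variable {A : Type*} [AddCommGroup A] [Fintype A] [DecidableEq A]
  {Q : QuadraticMap ℤ A (AddCircle (1 : ℚ))} {p : ℕ} [Fact p.Prime] {e : A ≃+ ZMod p} {α : ℤ}
  {k : ℤ} {χ : DirichletCharacter ℂ p} {F : ℍ → A → ℂ}

lemma coord_neg (hQ : IsNondegenerate Q) (hp : p ≠ 2)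
    (hα : ∀ n : ℤ, Q (e.symm (n : ZMod p)) = ((α * n ^ 2 / p : ℚ) : AddCircle (1 : ℚ)))
    (hχ : χ (-1) = (-1) ^ (k + halfSig Q)) (hF : F ∈ weakForms Q k) (x : ZMod p) (τ : ℍ) :
    coord e F (-x) τ = χ (-1) * coord e F x τ := by
  obtain ⟨-, hT, hS, -⟩ := (mem_weakForms_iff hα).1 hF
  rw [apply_neg_of_weil hp (alpha_ne_zero hQ hα) (gauss_eq_eSig8 hp hQ hα) hT hS,
    eSig8_sq_eq hp hQ hα, hχ, zpow_add₀ (by norm_num)]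

lemma char_neg (χ : DirichletCharacter ℂ p) (x : ZMod p) : χ (-x) = χ (-1) * χ x := by
  rw [← map_mul, neg_one_mul]

lemma char_neg_one_mul_self (χ : DirichletCharacter ℂ p) : χ (-1) * χ (-1) = 1 := by
  rw [← map_mul, neg_mul_neg, one_mul, map_one]

lemma ne_neg_self (hp : p ≠ 2) {x : ZMod p} (hx : x ≠ 0) : x ≠ -x := by
  exact ZMod.ne_neg_self ((Fact.out : p.Prime).odd_of_ne_two hp) hx

/-- The components `F_x(pτ)` have integral exponents lying in one class mod `p`. -/
lemma exists_coord_hasQExpansion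
    (hα : ∀ n : ℤ, Q (e.symm (n : ZMod p)) = ((α * n ^ 2 / p : ℚ) : AddCircle (1 : ℚ)))
    (hF : F ∈ weakForms Q k) (x : ZMod p) :
    ∃ c : ℤ → ℂ, (∀ n, c n ≠ 0 → (n : ZMod p) = -((α : ZMod p) * x ^ 2)) ∧
      HasQExpansion (fun τ => coord e F x (dilate p p_pos τ)) c := by
  have hp0 : (p : ℚ) ≠ 0 := by exact_mod_cast (Fact.out : p.Prime).ne_zero
  obtain ⟨-, -, -, hc⟩ := (mem_weakForms_iff hα).1 hF
  obtain ⟨c, hc, hs⟩ := hc x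
  refine ⟨_, fun n hn => ?_, hs.hasQExpansion (Fact.out : p.Prime).pos (fun n hn => ?_)
    (σ := dilate p p_pos) fun τ => by simp [coe_dilate]⟩
  · exact (coe_div_eq_neg_Q_iff hα n x).1 (hc _ hn)
  · have h1 := hc n hn
    have hx : ((x.val : ℤ) : ZMod p) = x := by simp
    have h2 := hα x.val
    rw [hx] at h2
    rw [h2, ← AddCircle.coe_neg, ← sub_eq_zero, ← AddCircle.coe_sub, AddCircle.coe_eq_zero_iff] at h1
    obtain ⟨t, ht⟩ := h1
    rw [zsmul_eq_mul, mul_one] at ht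
    refine ⟨p * t - α * (x.val : ℤ) ^ 2, ?_⟩
    push_cast
    rw [ht]
    push_cast
    field_simp
    ring

/-- The exponents of the components separate `{x, -x}` from the other indices, so that the
`x`-component of `φ_χ(F)` collects the contributions of `x` and `-x`. -/
lemma component_twistedComponentSum (hQ : IsNondegenerate Q) (hp : p ≠ 2)
    (hα : ∀ n : ℤ, Q (e.symm (n : ZMod p)) = ((α * n ^ 2 / p : ℚ) : AddCircle (1 : ℚ)))
    (hχ : χ (-1) = (-1) ^ (k + halfSig Q)) (hF : F ∈ weakForms Q k) :
    EpsCondition Q p (twistedComponentSum e χ F) ∧ ∀ (x : ZMod p) (τ : ℍ),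
      component Q p (twistedComponentSum e χ F) (e.symm x) τ
        = χ x * coord e F x (dilate p p_pos τ) := by
  have ha := alpha_ne_zero hQ hα
  choose c hc hcs using exists_coord_hasQExpansion hα hF
  have hsum : ∀ s : Finset (ZMod p), HasQExpansion
      (∑ x ∈ s, χ x • fun τ => coord e F x (dilate p p_pos τ)) (∑ x ∈ s, χ x • c x) := by
    intro s
    induction s using Finset.induction_on with
    | empty => simpa using HasQExpansion.zero
    | insert x s hx ih =>
      rw [Finset.sum_insert hx, Finset.sum_insert hx]
      exact ((hcs x).smul _).add ih
  have hG : HasQExpansion (twistedComponentSum e χ F) (∑ x, χ x • c x) := by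
    convert hsum Finset.univ using 1
    funext τ
    rw [twistedComponentSum_eq]
    simp
  have hneg : ∀ x, c (-x) = χ (-1) • c x := fun x => by
    refine (hcs (-x)).unique ?_
    convert (hcs x).smul (χ (-1)) using 1
    funext τ
    rw [coord_neg hQ hp hα hχ hF]
    simp
  have hclass : ∀ {n : ℤ} {x y : ZMod p}, (n : ZMod p) = -((α : ZMod p) * x ^ 2) → c y n ≠ 0 →
      y = x ∨ y = -x := fun {n x y} hn hy => by
    rw [hc y n hy, neg_inj] at hn
    exact sq_eq_sq_iff_eq_or_eq_neg.1 (mul_left_cancel₀ ha hn)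
  refine ⟨(EpsCondition_iff_coord hα).2 ⟨_, hG, fun n hn => ?_⟩, fun x τ => ?_⟩
  · rw [Finset.sum_apply] at hn
    obtain ⟨x, -, hx⟩ := Finset.exists_ne_zero_of_sum_ne_zero hn
    refine ⟨x, ?_, hc x n (right_ne_zero_of_mul hx)⟩
    rintro rfl
    exact left_ne_zero_of_mul hx (MulChar.map_zero _)
  · refine ((component_hasQExpansion hα hG x).2 τ).unique ?_
    refine (((hcs x).smul (χ x)).2 τ).congr_fun fun n => ?_
    simp only [Finset.sum_apply, Pi.smul_apply, smul_eq_mul]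
    congr 1
    split_ifs with hn
    · rcases eq_or_ne x 0 with rfl | hx
      · rw [Finset.sum_eq_zero fun y _ => ?_]
        · rw [MulChar.map_zero, zero_mul, zero_div]
        · by_contra h0
          have hy := hclass hn (right_ne_zero_of_mul h0)
          rw [neg_zero, or_self] at hy
          subst hy
          exact left_ne_zero_of_mul h0 (MulChar.map_zero _)
      · have hx' := ne_neg_self hp hx
        rw [← Finset.sum_subset (Finset.subset_univ {x, -x})]
        · rw [Finset.sum_pair hx', hneg, char_neg, Pi.smul_apply, smul_eq_mul]
          linear_combination (χ x * c x n / 2) * char_neg_one_mul_self χ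
        · intro y _ hy
          by_contra h0
          exact hy (Finset.mem_insert.2 ((hclass hn (right_ne_zero_of_mul h0)).imp_right
            Finset.mem_singleton.2))
    · by_contra h0
      exact hn (hc x n (right_ne_zero_of_mul (Ne.symm h0)))

lemma twist_twistedComponentSum (hQ : IsNondegenerate Q) (hp : p ≠ 2)
    (hα : ∀ n : ℤ, Q (e.symm (n : ZMod p)) = ((α * n ^ 2 / p : ℚ) : AddCircle (1 : ℚ)))
    (hχ : χ (-1) = (-1) ^ (k + halfSig Q)) (hF : F ∈ weakForms Q k)
    (ψ : DirichletCharacter ℂ p) (τ : ℍ) :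
    twist Q e ψ (twistedComponentSum e χ F) τ
      = ∑ x, (ψ * χ) x * coord e F x (dilate p p_pos τ) := by
  rw [twist_eq]
  refine Finset.sum_congr rfl fun x _ => ?_
  rw [(component_twistedComponentSum hQ hp hα hχ hF).2, MulChar.mul_apply, mul_assoc]

/-- The Fricke involution acts on character sums of the components through `S`. -/
lemma fricke_sum_coord
    (hα : ∀ n : ℤ, Q (e.symm (n : ZMod p)) = ((α * n ^ 2 / p : ℚ) : AddCircle (1 : ℚ)))
    (hF : F ∈ weakForms Q k) (ψ : DirichletCharacter ℂ p) (τ : ℍ) :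
    fricke p k (fun τ => ∑ x, ψ x * coord e F x (dilate p p_pos τ)) τ
      = eSig8 Q / (Real.sqrt p : ℝ) * ∑ y, (∑ x, ψ x *
        ZMod.stdAddChar (2 * (α : ZMod p) * y * x)) * coord e F y (dilate p p_pos τ) := by
  obtain ⟨-, -, hS, -⟩ := (mem_weakForms_iff hα).1 hF
  have h1 := fricke_comp_dilate (p := p) k (∑ x, ψ x • coord e F x) τ
  simp only [SlashAction.sum_slash, ModularForm.SL_smul_slash, hS, Finset.sum_apply, Pi.smul_apply,
    smul_eq_mul] at h1
  rw [h1]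
  simp only [Finset.mul_sum, Finset.sum_mul]
  rw [Finset.sum_comm]
  refine Finset.sum_congr rfl fun y _ => Finset.sum_congr rfl fun x _ => ?_
  rw [mul_right_comm _ x y]
  ring

lemma atkinLehner_twistedComponentSum (hQ : IsNondegenerate Q) (hp : p ≠ 2)
    (hα : ∀ n : ℤ, Q (e.symm (n : ZMod p)) = ((α * n ^ 2 / p : ℚ) : AddCircle (1 : ℚ)))
    (hχ : χ (-1) = (-1) ^ (k + halfSig Q)) (hF : F ∈ weakForms Q k) :
    AtkinLehnerCondition Q e α k χ (twistedComponentSum e χ F) := by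
  intro ψ hψ τ
  have hψχ : ψ * χ ≠ 1 := fun h => hψ (eq_inv_of_mul_eq_one_left h)
  have h1 : twist Q e ψ (twistedComponentSum e χ F)
      = fun τ => ∑ x, (ψ * χ) x * coord e F x (dilate p p_pos τ) :=
    funext fun τ => twist_twistedComponentSum hQ hp hα hχ hF ψ τ
  rw [h1, fricke_sum_coord hα hF, twist_twistedComponentSum hQ hp hα hχ hF, conj_char,
    show ψ⁻¹ * χ⁻¹ ^ 2 * χ = (ψ * χ)⁻¹ by
      rw [sq, mul_inv, mul_assoc, mul_assoc, inv_mul_cancel, mul_one]]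
  simp only [sum_char_mul_stdAddChar hψχ, map_mul, Finset.mul_sum]
  refine Finset.sum_congr rfl fun y _ => ?_
  push_cast
  rw [map_mul]
  ring

lemma reconstruct_twistedComponentSum (hQ : IsNondegenerate Q) (hp : p ≠ 2)
    (hα : ∀ n : ℤ, Q (e.symm (n : ZMod p)) = ((α * n ^ 2 / p : ℚ) : AddCircle (1 : ℚ)))
    (hχ : χ (-1) = (-1) ^ (k + halfSig Q)) (hF : F ∈ weakForms Q k) :
    reconstruct Q e k χ (twistedComponentSum e χ F) = F := by
  have hp1 : (p : ℂ) - 1 ≠ 0 := by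
    rw [sub_ne_zero]
    exact_mod_cast (Fact.out : p.Prime).one_lt.ne'
  have hs0 : eSig8 Q ≠ 0 := Complex.exp_ne_zero _
  have hr := sqrt_p_ne_zero (p := p)
  have h2a : (2 * (α : ZMod p)) ≠ 0 :=
    mul_ne_zero (zmod_two_ne_zero hp) (alpha_ne_zero hQ hα)
  funext τ γ
  obtain ⟨x, rfl⟩ := e.symm.surjective γ
  rw [reconstruct]
  split_ifs with hx
  · rw [map_eq_zero_iff _ e.symm.injective] at hx
    subst hx
    have h1 : twist Q e χ⁻¹ (twistedComponentSum e χ F)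
        = fun τ => ∑ x, (1 : DirichletCharacter ℂ p) x * coord e F x (dilate p p_pos τ) :=
      funext fun τ => by rw [twist_twistedComponentSum hQ hp hα hχ hF, inv_mul_cancel]
    rw [zeroComponent, h1, fricke_sum_coord hα hF]
    simp only [sum_one_char_mul_stdAddChar, dilate_dilate_inv, sum_one_char_mul, sub_mul, one_mul,
      Finset.sum_sub_distrib, ite_mul, zero_mul, mul_eq_zero, h2a, false_or, Finset.sum_ite_eq',
      Finset.mem_univ, if_true]
    rw [coord]
    field_simp
    ring
  · rw [(component_twistedComponentSum hQ hp hα hχ hF).2, dilate_dilate_inv, e.apply_symm_apply,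
      conj_char, ← mul_assoc, ← MulChar.mul_apply, inv_mul_cancel, MulChar.one_apply, one_mul, coord]
    rw [isUnit_iff_ne_zero]
    rintro rfl
    exact hx (map_zero _)

lemma meromorphicAtCusps_coord (hQ : IsNondegenerate Q) (hp : p ≠ 2)
    (hα : ∀ n : ℤ, Q (e.symm (n : ZMod p)) = ((α * n ^ 2 / p : ℚ) : AddCircle (1 : ℚ)))
    (hF : F ∈ weakForms Q k) (x : ZMod p) : MeromorphicAtCusps k (coord e F x) := by
  obtain ⟨-, hT, hS, -⟩ := (mem_weakForms_iff hα).1 hF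
  have hp0 : (p : ℚ) ≠ 0 := by exact_mod_cast (Fact.out : p.Prime).ne_zero
  have hinf : ∀ y, MeromorphicAtInfty (coord e F y) := fun y => by
    obtain ⟨c, -, hc⟩ := exists_coord_hasQExpansion hα hF y
    have h1 := hc.hasFourierExpansion (Fact.out : p.Prime).pos
      (σ := dilate (p : ℝ)⁻¹ (inv_pos.2 p_pos)) fun τ => by simp [coe_dilate]
    have h2 : (fun τ => coord e F y (dilate p p_pos τ)) ∘ dilate (p : ℝ)⁻¹ (inv_pos.2 p_pos)
        = coord e F y := by
      funext τ
      simp only [Function.comp_apply, dilate_dilate_inv]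
    rw [h2] at h1
    refine ⟨p, (Fact.out : p.Prime).pos, _, fun n hn => ?_, h1⟩
    · by_contra h0
      refine hn (Function.extend_apply' _ _ _ ?_)
      rintro ⟨m, rfl⟩
      exact h0 ⟨m, by field_simp⟩
  intro M
  rw [slash_eq_sum_weilCoeff hp (alpha_ne_zero hQ hα) (gauss_eq_eSig8 hp hQ hα) hT hS M x]
  exact .sum fun y _ => (hinf y).smul _

lemma mdifferentiable_comp_affine {f : ℍ → ℂ} (hf : MDifferentiable 𝓘(ℂ) 𝓘(ℂ) f) {σ : ℍ → ℍ}
    {r q : ℂ} (hσ : ∀ τ, (σ τ : ℂ) = r * τ + q) : MDifferentiable 𝓘(ℂ) 𝓘(ℂ) (f ∘ σ) := by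
  refine hf.comp fun τ => ?_
  have h1 : σ = ofComplex ∘ fun τ : ℍ => r * (τ : ℂ) + q := by
    funext τ
    rw [Function.comp_apply, ← hσ, ofComplex_apply]
  rw [h1]
  refine MDifferentiableAt.comp τ (mdifferentiableAt_ofComplex (by rw [← hσ]; exact (σ τ).im_pos)) ?_
  have h2 : DifferentiableAt ℂ (fun z : ℂ => r * z + q) τ := by fun_prop
  exact h2.mdifferentiableAt.comp τ (mdifferentiable_coe τ)

lemma twistedComponentSum_mem_scalarForms (hQ : IsNondegenerate Q) (hp : p ≠ 2)
    (hα : ∀ n : ℤ, Q (e.symm (n : ZMod p)) = ((α * n ^ 2 / p : ℚ) : AddCircle (1 : ℚ)))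
    (hF : F ∈ weakForms Q k) :
    twistedComponentSum e χ F ∈ scalarForms (p ^ 2) k
      (DirichletCharacter.changeLevel (dvd_pow_self p two_ne_zero) (χ * chiP p)) := by
  obtain ⟨hhol, hT, hS, -⟩ := (mem_weakForms_iff hα).1 hF
  have hG : twistedComponentSum e χ F = ∑ x, χ x • (coord e F x ∘ dilate p p_pos) := by
    funext τ
    rw [twistedComponentSum_eq]
    simp
  have hdil : ∀ τ, (dilate p p_pos τ : ℂ) = ((p : ℚ) : ℂ) * τ + ((0 : ℚ) : ℂ) := fun τ => by
    simp [coe_dilate]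
  have hp0 : (0 : ℚ) < p := by exact_mod_cast (Fact.out : p.Prime).pos
  refine ⟨?_, fun M hM τ => ?_, ?_⟩
  · rw [hG]
    exact MDifferentiable.sum fun x _ =>
      (mdifferentiable_comp_affine (hhol x) hdil).const_smul _
  · rw [CongruenceSubgroup.Gamma0_mem, ZMod.intCast_zmod_eq_zero_iff_dvd] at hM
    obtain ⟨t, ht⟩ := hM
    have hdet := M.det_coe
    rw [Matrix.det_fin_two] at hdet
    -- conjugation by the dilation carries `M` to an element of `Γ₀(p) ∩ Γ⁰(p)`
    let N : SL(2, ℤ) := ⟨!![M 0 0, p * M 0 1; p * t, M 1 1], by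
      rw [Matrix.det_fin_two_of]
      push_cast at ht
      linear_combination hdet + M 0 1 * ht⟩
    have hN00 : N 0 0 = M 0 0 := rfl
    have hN11 : N 1 1 = M 1 1 := rfl
    have hden : denom (N : GL (Fin 2) ℝ) (dilate p p_pos τ) = denom (M : GL (Fin 2) ℝ) τ := by
      rw [ModularGroup.denom_apply, ModularGroup.denom_apply, ht, hN11, coe_dilate]
      simp only [N, Matrix.of_apply, Matrix.cons_val_one,
        Matrix.cons_val_zero]
      push_cast
      ring
    have hpC : (p : ℂ) ≠ 0 := by exact_mod_cast (Fact.out : p.Prime).ne_zero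
    have hsm : dilate p p_pos (M • τ) = N • dilate p p_pos τ := by
      apply UpperHalfPlane.ext
      rw [coe_dilate, coe_specialLinearGroup_apply, coe_specialLinearGroup_apply, coe_dilate]
      simp only [N, Matrix.of_apply, Matrix.cons_val_one,
        Matrix.cons_val_zero, Matrix.cons_val', ht, algebraMap_int_eq,
        eq_intCast]
      push_cast
      rw [mul_div_assoc']
      congr 1 <;> ring
    have hAD : ((M 0 0 : ℤ) : ZMod p) * ((M 1 1 : ℤ) : ZMod p) = 1 := by
      have h1 := congrArg (Int.cast : ℤ → ZMod p) hdet
      rw [ht] at h1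
      push_cast at h1
      simpa using h1
    have hslash : ∀ x, coord e F x (dilate p p_pos (M • τ)) = denom (M : GL (Fin 2) ℝ) τ ^ k *
        (chiP p ((M 1 1 : ℤ) : ZMod p) * coord e F ((M 0 0 : ℤ) * x) (dilate p p_pos τ)) := by
      intro x
      have h1 := congrFun (slash_of_dvd hp (alpha_ne_zero hQ hα) (gauss_eq_eSig8 hp hQ hα) hT hS
        (M := N) (by simp [N]) (by simp [N]) x) (dilate p p_pos τ)
      rw [ModularForm.SL_slash_apply, hden, ← hsm, zpow_neg, ← div_eq_mul_inv,
        div_eq_iff (zpow_ne_zero _ (denom_ne_zero _ τ))] at h1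
      rw [h1, Pi.smul_apply, smul_eq_mul, hN00, hN11, mul_comm]
    have hunit : IsUnit ((M 1 1 : ℤ) : ZMod (p ^ 2)) := by
      refine IsUnit.of_mul_eq_one ((M 0 0 : ℤ) : ZMod (p ^ 2)) ?_
      have h1 := congrArg (Int.cast : ℤ → ZMod (p ^ 2)) hdet
      rw [ht] at h1
      have h2 : ((p : ZMod (p ^ 2))) ^ 2 = 0 := by exact_mod_cast ZMod.natCast_self (p ^ 2)
      push_cast at h1
      rw [h2] at h1
      linear_combination h1
    obtain ⟨u, hu⟩ := hunit
    have hchi : DirichletCharacter.changeLevel (dvd_pow_self p two_ne_zero) (χ * chiP p)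
        ((M 1 1 : ℤ) : ZMod (p ^ 2)) = χ ((M 1 1 : ℤ) : ZMod p) * chiP p ((M 1 1 : ℤ) : ZMod p) := by
      rw [← hu, DirichletCharacter.changeLevel_eq_cast_of_dvd, hu, ← MulChar.mul_apply,
        ZMod.cast_intCast (dvd_pow_self p two_ne_zero)]
    rw [hchi, twistedComponentSum_eq, twistedComponentSum_eq, Finset.mul_sum]
    have hA : ((M 0 0 : ℤ) : ZMod p) ≠ 0 := left_ne_zero_of_mul_eq_one hAD
    refine Fintype.sum_equiv (Equiv.mulLeft₀ _ hA) _ _ fun x => ?_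
    have h3 : χ x = χ ((M 1 1 : ℤ) : ZMod p) * χ ((M 0 0 : ℤ) * x) := by
      rw [← map_mul, ← mul_assoc, mul_comm ((M 1 1 : ℤ) : ZMod p), hAD, one_mul]
    rw [hslash, Equiv.mulLeft₀_apply, h3]
    ring
  · rw [hG]
    exact MeromorphicAtCusps.sum fun x _ =>
      ((meromorphicAtCusps_coord hQ hp hα hF x).comp_affine hp0 hdil).smul _

end Forward

/-! ### The relation between `S` and `T` -/

section Relation

variable {p : ℕ} [Fact p.Prime] {a : ZMod p} {s : ℂ} {k : ℤ} {f : ZMod p → ℍ → ℂ}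

/-- If all components transform correctly under `S`, and all but the zero component under `T`, then
comparing `STS` with `T⁻¹ST⁻¹` yields `D|S = -ζ(a x²) D'` for every `x ≠ 0`, where `D` and `D'` are
the defects of periodicity `f₀|T - f₀` and `f₀ - f₀|T⁻¹`. Two distinct values of `a x²` force both
to vanish. -/
theorem zero_component_slash_T (hp : p ≠ 2) (hp3 : p ≠ 3) (ha : a ≠ 0)
    (hs : ∑ y : ZMod p, ZMod.stdAddChar (a * y ^ 2) = (Real.sqrt p : ℝ) * s)
    (hs0 : s ≠ 0)
    (hT : ∀ x ≠ 0, f x ∣[k] ModularGroup.T = (ZMod.stdAddChar (-(a * x ^ 2)) : ℂ) • f x)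
    (hS : ∀ x, f x ∣[k] ModularGroup.S
      = ∑ y, (s / (Real.sqrt p : ℝ) * ZMod.stdAddChar (2 * a * x * y)) • f y) :
    f 0 ∣[k] ModularGroup.T = f 0 := by
  have hr := sqrt_p_ne_zero (p := p)
  set κ : ℂ := s / (Real.sqrt p : ℝ) with hκ
  have hκ0 : κ ≠ 0 := div_ne_zero hs0 hr
  have hTi : ∀ x ≠ 0, f x ∣[k] ModularGroup.T⁻¹ = (ZMod.stdAddChar (a * x ^ 2) : ℂ) • f x := by
    intro x hx
    have h1 := congrArg (fun g : ℍ → ℂ => g ∣[k] ModularGroup.T⁻¹) (hT x hx)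
    simp only [← SlashAction.slash_mul, mul_inv_cancel, SlashAction.slash_one,
      ModularForm.SL_smul_slash] at h1
    rw [h1, smul_smul, ← AddChar.map_add_eq_mul, h1.symm]
    simp
  set D : ℍ → ℂ := f 0 ∣[k] ModularGroup.T - f 0 with hD
  set D' : ℍ → ℂ := f 0 - f 0 ∣[k] ModularGroup.T⁻¹ with hD'
  have hTall : ∀ x, f x ∣[k] ModularGroup.T
      = (ZMod.stdAddChar (-(a * x ^ 2)) : ℂ) • f x + if x = 0 then D else 0 := by
    intro x
    split_ifs with hx
    · subst hx
      simp [hD]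
    · rw [hT x hx, add_zero]
  have hTiall : ∀ x, f x ∣[k] ModularGroup.T⁻¹
      = (ZMod.stdAddChar (a * x ^ 2) : ℂ) • f x - if x = 0 then D' else 0 := by
    intro x
    split_ifs with hx
    · subst hx
      simp [hD']
    · rw [hTi x hx, sub_zero]
  have hrel : ModularGroup.S * ModularGroup.T * ModularGroup.S
      = ModularGroup.T⁻¹ * ModularGroup.S * ModularGroup.T⁻¹ := by decide +kernel
  -- the Weil representation itself satisfies the relation, so only the defects survive
  have hgauss : ∀ x z : ZMod p, ∑ y, κ * ZMod.stdAddChar (2 * a * x * y) *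
      (ZMod.stdAddChar (-(a * y ^ 2)) * (κ * ZMod.stdAddChar (2 * a * y * z)))
      = κ * (ZMod.stdAddChar (a * x ^ 2) *
        (ZMod.stdAddChar (2 * a * x * z) * ZMod.stdAddChar (a * z ^ 2))) := by
    intro x z
    have h1 : ∀ y : ZMod p, κ * ZMod.stdAddChar (2 * a * x * y) *
      (ZMod.stdAddChar (-(a * y ^ 2)) * (κ * ZMod.stdAddChar (2 * a * y * z)))
      = κ ^ 2 * ZMod.stdAddChar (-1 * a * y ^ 2 + 2 * (a * (x + z)) * y) := fun y => by
      have : (ZMod.stdAddChar (2 * a * x * y) : ℂ) * ZMod.stdAddChar (-(a * y ^ 2)) *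
          ZMod.stdAddChar (2 * a * y * z)
          = ZMod.stdAddChar (-1 * a * y ^ 2 + 2 * (a * (x + z)) * y) := by
        rw [← AddChar.map_add_eq_mul, ← AddChar.map_add_eq_mul]
        congr 1
        ring
      rw [← this]
      ring
    rw [Finset.sum_congr rfl fun y _ => h1 y, ← Finset.mul_sum,
      stdAddChar_complete_square (mul_ne_zero (neg_ne_zero.2 one_ne_zero) ha),
      gauss_mul hp ha hs (neg_ne_zero.2 one_ne_zero), ← gauss_sq hp ha hs,
      ← AddChar.map_add_eq_mul, ← AddChar.map_add_eq_mul]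
    have h2 : -((a * (x + z)) ^ 2 / (-1 * a)) = a * x ^ 2 + (2 * a * x * z + a * z ^ 2) := by
      field_simp
      ring
    have h4 : s ^ 4 = 1 := by
      rw [show s ^ 4 = s ^ 2 * s ^ 2 by ring, gauss_sq hp ha hs,
        chiP_mul_self (neg_ne_zero.2 one_ne_zero)]
    rw [h2]
    generalize (ZMod.stdAddChar (a * x ^ 2 + (2 * a * x * z + a * z ^ 2)) : ℂ) = E
    rw [hκ]
    field_simp
    linear_combination E * h4
  have key : ∀ x ≠ 0, D ∣[k] ModularGroup.S = -((ZMod.stdAddChar (a * x ^ 2) : ℂ) • D') := by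
    intro x hx
    have hL : f x ∣[k] (ModularGroup.S * ModularGroup.T * ModularGroup.S)
        = ∑ z, (κ * (ZMod.stdAddChar (a * x ^ 2) *
          (ZMod.stdAddChar (2 * a * x * z) * ZMod.stdAddChar (a * z ^ 2)))) • f z
          + κ • (D ∣[k] ModularGroup.S) := by
      have hite : ∀ y : ZMod p, (if y = 0 then D else 0) ∣[k] ModularGroup.S
          = if y = 0 then D ∣[k] ModularGroup.S else 0 := fun y => by
        split_ifs
        · rfl
        · exact SlashAction.zero_slash _ _
      simp only [SlashAction.slash_mul, hS, SlashAction.sum_slash, ModularForm.SL_smul_slash, hTall,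
        SlashAction.add_slash, smul_add, Finset.sum_add_distrib, hite, Finset.smul_sum, smul_smul]
      congr 1
      · rw [Finset.sum_comm]
        refine Finset.sum_congr rfl fun z _ => ?_
        rw [← Finset.sum_smul, ← hgauss]
        simp only [mul_assoc]
      · rw [Finset.sum_eq_single 0]
        · simp
        · intro y _ hy
          rw [if_neg hy, smul_zero]
        · simp
    have hR : f x ∣[k] (ModularGroup.T⁻¹ * ModularGroup.S * ModularGroup.T⁻¹)
        = ∑ z, (κ * (ZMod.stdAddChar (a * x ^ 2) *
          (ZMod.stdAddChar (2 * a * x * z) * ZMod.stdAddChar (a * z ^ 2)))) • f z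
          - (κ * ZMod.stdAddChar (a * x ^ 2)) • D' := by
      rw [SlashAction.slash_mul, SlashAction.slash_mul, hTi x hx]
      simp only [ModularForm.SL_smul_slash, hS, SlashAction.sum_slash, hTiall, smul_sub,
        Finset.sum_sub_distrib, Finset.smul_sum, smul_smul]
      congr 1
      · refine Finset.sum_congr rfl fun z _ => ?_
        congr 1
        ring
      · rw [Finset.sum_eq_single 0]
        · simp [mul_comm]
        · intro y _ hy
          rw [if_neg hy, smul_zero]
        · simp
    rw [hrel, hR, sub_eq_add_neg] at hL
    have h1 := add_left_cancel hL
    rw [mul_smul, ← smul_neg] at h1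
    exact (smul_right_injective (ℍ → ℂ) hκ0 h1).symm
  have h2 : (2 : ZMod p) ≠ 0 := zmod_two_ne_zero hp
  have h3 : (3 : ZMod p) ≠ 0 := fun h => by
    have h1 : ((3 : ℕ) : ZMod p) = 0 := by exact_mod_cast h
    rw [ZMod.natCast_eq_zero_iff] at h1
    exact hp3 ((Nat.prime_dvd_prime_iff_eq Fact.out Nat.prime_three).1 h1)
  -- the values `a` and `4a` of the form are distinct since `p ∤ 6`
  have h5 : ((ZMod.stdAddChar (a * 1 ^ 2) : ℂ) - ZMod.stdAddChar (a * 2 ^ 2)) • D' = 0 := by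
    rw [sub_smul, sub_eq_zero]
    exact neg_injective ((key 1 one_ne_zero).symm.trans (key 2 h2))
  have h6 : D' = 0 := by
    refine (smul_eq_zero.1 h5).resolve_left fun h => ?_
    have h7 := ZMod.injective_stdAddChar (sub_eq_zero.1 h)
    have h8 : 3 * a = 0 := by linear_combination -h7
    exact (mul_ne_zero h3 ha) h8
  have h9 := key 1 one_ne_zero
  rw [h6, smul_zero, neg_zero, SlashAction.slash_eq_zero_iff] at h9
  rw [hD] at h9
  exact sub_eq_zero.1 h9

end Relation

/-! ### Components of a scalar-valued form -/

section Components

lemma component_neg {p : ℕ} {A : Type*} [AddCommGroup A]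
    {Q : QuadraticMap ℤ A (AddCircle (1 : ℚ))} {G : ℍ → ℂ} (γ : A) : component Q p G (-γ) = component Q p G γ := by
  unfold component
  rw [QuadraticMap.map_neg]

variable {p : ℕ} [Fact p.Prime] {A : Type*} [AddCommGroup A]
  {Q : QuadraticMap ℤ A (AddCircle (1 : ℚ))} {e : A ≃+ ZMod p} {α : ℤ} {G : ℍ → ℂ} {d : ℤ → ℂ}

/-- The components of `G` are averages of translates of `G`. -/
lemma component_eq_sum_translates
    (hα : ∀ n : ℤ, Q (e.symm (n : ZMod p)) = ((α * n ^ 2 / p : ℚ) : AddCircle (1 : ℚ)))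
    (hG : HasQExpansion G d) (x : ZMod p) :
    component Q p G (e.symm x) = ∑ j : ZMod p,
      (1 / (2 * p) * ZMod.stdAddChar (((α : ZMod p) * x ^ 2) * j) : ℂ) •
        (G ∘ fun τ : ℍ => ((j.val / p : ℝ) +ᵥ τ)) := by
  have hp : (p : ℂ) ≠ 0 := by exact_mod_cast (Fact.out : p.Prime).ne_zero
  funext τ
  refine ((component_hasQExpansion hα hG x).2 τ).unique ?_
  have h1 : ∀ j : ZMod p, HasSum (fun n : ℤ =>
      (1 / (2 * p) * ZMod.stdAddChar (((α : ZMod p) * x ^ 2) * j) : ℂ) *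
        (d n * qpow n τ * ZMod.stdAddChar ((n : ZMod p) * j)))
      ((1 / (2 * p) * ZMod.stdAddChar (((α : ZMod p) * x ^ 2) * j) : ℂ) *
        G ((j.val / p : ℝ) +ᵥ τ)) := fun j => by
    refine HasSum.mul_left _ ((hG.2 _).congr_fun fun n => ?_)
    have hj : ((n : ZMod p) * j) = ((n * (j.val : ℤ) : ℤ) : ZMod p) := by simp
    rw [hj, ZMod.stdAddChar_coe, mul_assoc, qpow, qpow, ← Complex.exp_add, coe_vadd]
    congr 2
    push_cast
    field_simp
    ring
  have h2 := hasSum_sum (s := Finset.univ) fun j _ => h1 j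
  rw [Finset.sum_apply]
  refine h2.congr_fun fun n => ?_
  have h3 : ∀ j : ZMod p, (1 / (2 * p) * ZMod.stdAddChar (((α : ZMod p) * x ^ 2) * j) : ℂ) *
        (d n * qpow n τ * ZMod.stdAddChar ((n : ZMod p) * j))
      = d n * qpow n τ / (2 * p) * ZMod.stdAddChar (((n : ZMod p) + (α : ZMod p) * x ^ 2) * j) := fun j => by
    rw [add_mul, AddChar.map_add_eq_mul]
    ring
  rw [Finset.sum_congr rfl fun j _ => h3 j, ← Finset.mul_sum, sum_stdAddChar_mul]
  simp only [← eq_neg_iff_add_eq_zero]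
  split_ifs
  · field_simp
  · simp

lemma mdifferentiable_component
    (hα : ∀ n : ℤ, Q (e.symm (n : ZMod p)) = ((α * n ^ 2 / p : ℚ) : AddCircle (1 : ℚ)))
    (hG : HasQExpansion G d) (hhol : MDifferentiable 𝓘(ℂ) 𝓘(ℂ) G) (x : ZMod p) :
    MDifferentiable 𝓘(ℂ) 𝓘(ℂ) (component Q p G (e.symm x)) := by
  rw [component_eq_sum_translates hα hG]
  exact MDifferentiable.sum fun j _ => (mdifferentiable_comp_affine hhol (r := 1)
    (q := (j.val / p : ℝ)) fun τ => by rw [coe_vadd]; push_cast; ring).const_smul _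

lemma meromorphicAtCusps_component {k : ℤ}
    (hα : ∀ n : ℤ, Q (e.symm (n : ZMod p)) = ((α * n ^ 2 / p : ℚ) : AddCircle (1 : ℚ)))
    (hG : HasQExpansion G d) (hmer : MeromorphicAtCusps k G) (x : ZMod p) :
    MeromorphicAtCusps k (component Q p G (e.symm x)) := by
  rw [component_eq_sum_translates hα hG]
  exact MeromorphicAtCusps.sum fun j _ => (hmer.comp_affine (r := 1)
    (q := (j.val / p : ℚ)) one_pos fun τ => by rw [coe_vadd]; push_cast; ring).smul _

lemma HasFourierExpansion.apply_T_smul {f : ℍ → ℂ} {c : ℚ → ℂ} (hf : HasFourierExpansion f c)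
    {t : AddCircle (1 : ℚ)} (hc : ∀ n, c n ≠ 0 → ((n : ℚ) : AddCircle (1 : ℚ)) = t) (τ : ℍ) :
    f (ModularGroup.T • τ) = eQZ t * f τ := by
  refine (hf.2 _).unique (((hf.2 τ).mul_left (eQZ t)).congr_fun fun n => ?_)
  by_cases h0 : c n = 0
  · simp [h0]
  · rw [← hc n h0, eQZ_coe, mul_left_comm, qpow, qpow, ← Complex.exp_add, modular_T_smul, coe_vadd]
    congr 2
    push_cast
    ring

end Components

/-- Orthogonality of Dirichlet characters: a function on `ℤ/p` whose character sums all vanish is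
supported at `0`. -/
lemma eq_zero_of_sum_char_eq_zero {p : ℕ} [Fact p.Prime] {h : ZMod p → ℂ}
    (hh : ∀ ψ : DirichletCharacter ℂ p, ∑ x, ψ x * h x = 0) {x : ZMod p} (hx : x ≠ 0) :
    h x = 0 := by
  have h1 : ∑ ψ : DirichletCharacter ℂ p, ψ x⁻¹ * ∑ y, ψ y * h y = (p.totient : ℂ) * h x := by
    simp only [Finset.mul_sum, ← mul_assoc]
    rw [Finset.sum_comm]
    simp only [← Finset.sum_mul,
      DirichletCharacter.sum_char_inv_mul_char_eq ℂ (isUnit_iff_ne_zero.2 hx)]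
    simp
  simp only [hh, mul_zero, Finset.sum_const_zero] at h1
  exact (mul_eq_zero.1 h1.symm).resolve_left
    (by exact_mod_cast (Nat.totient_pos.2 (Fact.out : p.Prime).pos).ne')

/-! ### From scalar-valued forms to vector-valued forms -/

section Backward

variable {A : Type*} [AddCommGroup A] [Fintype A] [DecidableEq A]
  {Q : QuadraticMap ℤ A (AddCircle (1 : ℚ))} {p : ℕ} [Fact p.Prime] {e : A ≃+ ZMod p} {α : ℤ}
  {k : ℤ} {χ : DirichletCharacter ℂ p} {G : ℍ → ℂ}

lemma coord_reconstruct_zero : coord e (reconstruct Q e k χ G) 0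
    = fun τ => zeroComponent Q e k χ G (dilate (p : ℝ)⁻¹ (inv_pos.2 p_pos) τ) := by
  funext τ
  rw [coord, reconstruct, if_pos (map_zero _)]

lemma coord_reconstruct {x : ZMod p} (hx : x ≠ 0) : coord e (reconstruct Q e k χ G) x
    = χ⁻¹ x • (component Q p G (e.symm x) ∘ dilate (p : ℝ)⁻¹ (inv_pos.2 p_pos)) := by
  funext τ
  rw [coord, reconstruct, if_neg (by rwa [map_eq_zero_iff _ e.symm.injective]), e.apply_symm_apply,
    conj_char]
  rfl

/-- The weights `χ⁻¹(x)` in `Ψ_χ(G)` turn the twist by `ψ` into the `ψχ`-sum of the components. -/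
lemma twist_eq_sum_coord_reconstruct (ψ : DirichletCharacter ℂ p) :
    twist Q e ψ G = fun τ =>
      (∑ x, (ψ * χ) x • coord e (reconstruct Q e k χ G) x) (dilate p p_pos τ) := by
  funext τ
  rw [twist_eq, Finset.sum_apply]
  refine Finset.sum_congr rfl fun x _ => ?_
  rcases eq_or_ne x 0 with rfl | hx
  · rw [Pi.smul_apply, MulChar.map_zero, MulChar.map_zero, zero_mul, zero_smul]
  · rw [coord_reconstruct hx, smul_smul, ← MulChar.mul_apply, mul_inv_cancel_right, Pi.smul_apply,
      Function.comp_apply, dilate_inv_dilate, smul_eq_mul]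

lemma fricke_twist_eq_slash (ψ : DirichletCharacter ℂ p) (τ : ℍ) :
    fricke p k (twist Q e ψ G) τ
      = ((∑ x, (ψ * χ) x • coord e (reconstruct Q e k χ G) x) ∣[k] ModularGroup.S)
        (dilate p p_pos τ) := by
  rw [twist_eq_sum_coord_reconstruct (k := k) (χ := χ) ψ]
  exact fricke_comp_dilate k _ τ

/-- The `ε`-condition says that `G` is the sum of its components. -/
lemma twistedComponentSum_reconstruct (hQ : IsNondegenerate Q) (hp : p ≠ 2)
    (hα : ∀ n : ℤ, Q (e.symm (n : ZMod p)) = ((α * n ^ 2 / p : ℚ) : AddCircle (1 : ℚ)))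
    (hG : EpsCondition Q p G) :
    twistedComponentSum e χ (reconstruct Q e k χ G) = G := by
  obtain ⟨c, hc, hc'⟩ := (EpsCondition_iff_coord hα).1 hG
  have ha := alpha_ne_zero hQ hα
  have h1 : twistedComponentSum e χ (reconstruct Q e k χ G) = twist Q e 1 G := by
    rw [twist_eq_sum_coord_reconstruct (k := k) (χ := χ)]
    funext τ
    rw [twistedComponentSum_eq, one_mul, Finset.sum_apply]
    rfl
  rw [h1]
  funext τ
  rw [twist_eq]
  have h2 := hasSum_sum (s := Finset.univ) fun x _ =>
    ((component_hasQExpansion hα hc x).2 τ).mul_left ((1 : DirichletCharacter ℂ p) x)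
  refine h2.unique ((hc.2 τ).congr_fun fun n => ?_)
  rw [sum_one_char_mul]
  by_cases hn : c n = 0
  · simp [hn]
  obtain ⟨x, hx, hxn⟩ := hc' n hn
  have h3 : ∀ y : ZMod p, (n : ZMod p) = -((α : ZMod p) * y ^ 2) ↔ y = x ∨ y = -x := fun y => by
    rw [hxn, neg_inj, mul_right_inj' ha, eq_comm, sq_eq_sq_iff_eq_or_eq_neg]
  simp only [h3]
  rw [← Finset.sum_subset (Finset.subset_univ {x, -x}), Finset.sum_pair (ne_neg_self hp hx)]
  · simp only [true_or, or_true, if_true, hx.symm, zero_eq_neg, hx, or_self, if_false]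
    ring
  · intro y _ hy
    rw [if_neg (by simpa using hy), zero_mul]

lemma slash_S_slash_S (f : ℍ → ℂ) :
    (f ∣[k] ModularGroup.S) ∣[k] ModularGroup.S = ((-1 : ℂ) ^ k) • f := by
  have h : ModularGroup.S * ModularGroup.S = -1 := by decide +kernel
  rw [← SlashAction.slash_mul, h]
  funext τ
  have hd : denom ((-1 : SL(2, ℤ)) : GL (Fin 2) ℝ) τ = -1 := by
    rw [ModularGroup.denom_apply]; simp
  rw [ModularForm.SL_slash_apply, hd, ModularGroup.SL_neg_smul, one_smul, Pi.smul_apply,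
    smul_eq_mul, mul_comm, zpow_neg, ← inv_zpow, inv_neg_one]

/-- The sum of the nonzero components vanishes unless `χ` is even. -/
lemma sum_coord_reconstruct_parity :
    (∑ x, (1 : DirichletCharacter ℂ p) x • coord e (reconstruct Q e k χ G) x)
      = χ (-1) • ∑ x, (1 : DirichletCharacter ℂ p) x • coord e (reconstruct Q e k χ G) x := by
  rw [Finset.smul_sum]
  refine Fintype.sum_equiv (Equiv.neg _) _ _ fun x => ?_
  rcases eq_or_ne x 0 with rfl | hx
  · simp only [Equiv.neg_apply, neg_zero, MulChar.map_zero, zero_smul, smul_zero]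
  · rw [Equiv.neg_apply, coord_reconstruct hx, coord_reconstruct (neg_ne_zero.2 hx), map_neg e.symm,
      component_neg, MulChar.one_apply (isUnit_iff_ne_zero.2 hx),
      MulChar.one_apply (isUnit_iff_ne_zero.2 (neg_ne_zero.2 hx)), one_smul, one_smul, smul_smul,
      char_neg χ⁻¹ x, ← mul_assoc, ← MulChar.mul_apply, mul_inv_cancel,
      MulChar.one_apply (isUnit_iff_ne_zero.2 (neg_ne_zero.2 one_ne_zero)), one_mul]

lemma coord_reconstruct_zero_eq : coord e (reconstruct Q e k χ G) 0
    = (((Real.sqrt p : ℝ) : ℂ) / ((p : ℂ) - 1) * (eSig8 Q)⁻¹) •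
        ((∑ x, (1 : DirichletCharacter ℂ p) x • coord e (reconstruct Q e k χ G) x)
          ∣[k] ModularGroup.S)
      + (1 / ((p : ℂ) - 1)) •
        ∑ x, (1 : DirichletCharacter ℂ p) x • coord e (reconstruct Q e k χ G) x := by
  rw [coord_reconstruct_zero]
  funext τ
  rw [zeroComponent, fricke_twist_eq_slash (k := k) (χ := χ),
    twist_eq_sum_coord_reconstruct (k := k) (χ := χ), inv_mul_cancel]
  simp only [dilate_dilate_inv]
  rfl

/-- The Atkin–Lehner condition gives the `S`-transformation of all character sums of the components
except the trivial one, which is supplied by the definition of the zero component. -/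
lemma coord_reconstruct_slash_S (hQ : IsNondegenerate Q) (hp : p ≠ 2)
    (hα : ∀ n : ℤ, Q (e.symm (n : ZMod p)) = ((α * n ^ 2 / p : ℚ) : AddCircle (1 : ℚ)))
    (hχ : χ (-1) = (-1) ^ (k + halfSig Q)) (hAL : AtkinLehnerCondition Q e α k χ G) (x : ZMod p) :
    coord e (reconstruct Q e k χ G) x ∣[k] ModularGroup.S
      = ∑ y, (eSig8 Q / (Real.sqrt p : ℝ) * ZMod.stdAddChar (2 * (α : ZMod p) * x * y)) •
        coord e (reconstruct Q e k χ G) y := by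
  set f := coord e (reconstruct Q e k χ G) with hf
  set H : ℍ → ℂ := ∑ x, (1 : DirichletCharacter ℂ p) x • f x with hH
  have hp1 : (p : ℂ) - 1 ≠ 0 := by
    rw [sub_ne_zero]
    exact_mod_cast (Fact.out : p.Prime).one_lt.ne'
  have hs0 : eSig8 Q ≠ 0 := Complex.exp_ne_zero _
  have hr := sqrt_p_ne_zero (p := p)
  have hr2 := sqrt_p_sq (p := p)
  have h2a : (2 * (α : ZMod p)) ≠ 0 :=
    mul_ne_zero (zmod_two_ne_zero hp) (alpha_ne_zero hQ hα)
  have h0 : f 0 = (((Real.sqrt p : ℝ) : ℂ) / ((p : ℂ) - 1) * (eSig8 Q)⁻¹) •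
      (H ∣[k] ModularGroup.S) + (1 / ((p : ℂ) - 1)) • H := coord_reconstruct_zero_eq
  have hHsum : ∀ τ, H τ = ∑ y, f y τ - f 0 τ := fun τ => by
    rw [hH, Finset.sum_apply]
    exact sum_one_char_mul fun y => f y τ
  rcases eq_or_ne x 0 with rfl | hx
  · -- by parity, either `H = 0` or `(-1)^k = (-1)^{sig/2} = 𝐞(sig/4)`
    have hHs : (-1 : ℂ) ^ k • H = (eSig8 Q) ^ 2 • H := by
      have h1 : H = χ (-1) • H := sum_coord_reconstruct_parity
      have h2 : (-1 : ℂ) ^ k * (-1) ^ k = 1 := by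
        rw [← mul_zpow, neg_mul_neg, one_mul, one_zpow]
      conv_lhs => rw [h1]
      rw [hχ, zpow_add₀ (by norm_num), ← eSig8_sq_eq hp hQ hα, smul_smul, ← mul_assoc, h2, one_mul]
    conv_lhs => rw [h0]
    rw [SlashAction.add_slash, ModularForm.SL_smul_slash, ModularForm.SL_smul_slash,
      slash_S_slash_S, hHs]
    funext τ
    have h0τ := congrFun h0 τ
    have hHτ := hHsum τ
    simp only [Pi.add_apply, Pi.smul_apply, smul_eq_mul, Finset.sum_apply, mul_zero, zero_mul,
      AddChar.map_zero_eq_one, mul_one, ← Finset.mul_sum] at h0τ ⊢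
    rw [show ∑ y, f y τ = H τ + f 0 τ by rw [hHτ]; ring, h0τ]
    generalize (H ∣[k] ModularGroup.S) τ = X
    generalize H τ = Y
    field_simp
    linear_combination (eSig8 Q * Y) * hr2
  · have key : ∀ (τ : ℍ) (ψ : DirichletCharacter ℂ p), ∑ x, ψ x * ((f x ∣[k] ModularGroup.S) τ
        - ∑ y, (eSig8 Q / (Real.sqrt p : ℝ) *
          ZMod.stdAddChar (2 * (α : ZMod p) * x * y)) * f y τ) = 0 := by
      intro τ ψ
      have hR : ∑ x, ψ x * ∑ y, (eSig8 Q / (Real.sqrt p : ℝ) *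
            ZMod.stdAddChar (2 * (α : ZMod p) * x * y)) * f y τ
          = eSig8 Q / (Real.sqrt p : ℝ) * ∑ y, (∑ x, ψ x *
            ZMod.stdAddChar (2 * (α : ZMod p) * y * x)) * f y τ := by
        simp only [Finset.mul_sum, Finset.sum_mul]
        rw [Finset.sum_comm]
        refine Finset.sum_congr rfl fun y _ => Finset.sum_congr rfl fun x _ => ?_
        rw [mul_right_comm _ x y]
        ring
      have hL : ∑ x, ψ x * (f x ∣[k] ModularGroup.S) τ
          = ((∑ x, ψ x • f x) ∣[k] ModularGroup.S) τ := by
        simp only [SlashAction.sum_slash, ModularForm.SL_smul_slash, Finset.sum_apply, Pi.smul_apply,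
          smul_eq_mul]
      simp only [mul_sub, Finset.sum_sub_distrib]
      rw [hR, hL, sub_eq_zero]
      rcases eq_or_ne ψ 1 with rfl | hψ
      · have h0τ := congrFun h0 τ
        have hHτ := hHsum τ
        simp only [sum_one_char_mul_stdAddChar, sub_mul, one_mul, Finset.sum_sub_distrib, ite_mul,
          zero_mul, mul_eq_zero, h2a, false_or, Finset.sum_ite_eq', Finset.mem_univ, if_true]
        rw [show ∑ y, f y τ = H τ + f 0 τ by rw [hHτ]; ring]
        simp only [Pi.add_apply, Pi.smul_apply, smul_eq_mul] at h0τ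
        rw [h0τ, ← hH]
        field_simp
        ring
      · have hψ' : ψ * χ⁻¹ ≠ χ⁻¹ := fun h => hψ (mul_eq_right.1 h)
        have h1 := hAL (ψ * χ⁻¹) hψ' (dilate (p : ℝ)⁻¹ (inv_pos.2 p_pos) τ)
        rw [fricke_twist_eq_slash (k := k) (χ := χ), twist_eq_sum_coord_reconstruct (k := k) (χ := χ),
          dilate_dilate_inv, inv_mul_cancel_right, conj_char,
          show (ψ * χ⁻¹)⁻¹ * χ⁻¹ ^ 2 * χ = ψ⁻¹ by
            rw [mul_inv, inv_inv, sq]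
            simp [mul_assoc]] at h1
        rw [h1]
        simp only [dilate_dilate_inv, sum_char_mul_stdAddChar hψ, map_mul, Finset.mul_sum,
          Finset.sum_apply, Pi.smul_apply, smul_eq_mul]
        refine Finset.sum_congr rfl fun y _ => ?_
        push_cast
        rw [map_mul]
        ring
    funext τ
    have h1 := eq_zero_of_sum_char_eq_zero (key τ) hx
    rw [sub_eq_zero] at h1
    rw [h1, Finset.sum_apply]
    rfl

lemma eq_one_or_neg_one_of_zmod_three : ∀ v : ZMod 3, v ≠ 0 → v = 1 ∨ v = -1 := by decide

/-- Except for `p = 3` and `χ = 1`, every form satisfying both conditions comes from a vector-valued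
form. -/
theorem reconstruct_mem_weakForms (hQ : IsNondegenerate Q) (hp : p ≠ 2)
    (hα : ∀ n : ℤ, Q (e.symm (n : ZMod p)) = ((α * n ^ 2 / p : ℚ) : AddCircle (1 : ℚ)))
    (hχ : χ (-1) = (-1) ^ (k + halfSig Q)) (hex : ¬ (p = 3 ∧ χ = 1))
    (hG : G ∈ epsALForms Q e α k χ) : reconstruct Q e k χ G ∈ weakForms Q k := by
  obtain ⟨⟨hhol, -, hmer⟩, hEps, hAL⟩ := hG
  obtain ⟨c, hc, -⟩ := (EpsCondition_iff_coord hα).1 hEps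
  have hS := coord_reconstruct_slash_S hQ hp hα hχ hAL
  have h0 := coord_reconstruct_zero_eq (Q := Q) (e := e) (k := k) (χ := χ) (G := G)
  have hpar := sum_coord_reconstruct_parity (Q := Q) (e := e) (k := k) (χ := χ) (G := G)
  have hrec : ∀ x ≠ 0, coord e (reconstruct Q e k χ G) x
      = χ⁻¹ x • (component Q p G (e.symm x) ∘ dilate (p : ℝ)⁻¹ (inv_pos.2 p_pos)) :=
    fun x hx => coord_reconstruct hx
  set f := coord e (reconstruct Q e k χ G) with hf
  set H : ℍ → ℂ := ∑ x, (1 : DirichletCharacter ℂ p) x • f x with hH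
  have hdil : ∀ τ : ℍ, (dilate (p : ℝ)⁻¹ (inv_pos.2 p_pos) τ : ℂ)
      = (((p : ℚ)⁻¹ : ℚ) : ℂ) * τ + ((0 : ℚ) : ℂ) := fun τ => by
    simp [coe_dilate]
  have hp0 : (0 : ℚ) < (p : ℚ)⁻¹ := inv_pos.2 (by exact_mod_cast (Fact.out : p.Prime).pos)
  have hholx : ∀ x ≠ 0, MDifferentiable 𝓘(ℂ) 𝓘(ℂ) (f x) := fun x hx => by
    rw [hrec x hx]
    exact (mdifferentiable_comp_affine (mdifferentiable_component hα hc hhol x) hdil).const_smul _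
  have hmerx : ∀ x ≠ 0, MeromorphicAtCusps k (f x) := fun x hx => by
    rw [hrec x hx]
    exact ((meromorphicAtCusps_component hα hc hmer x).comp_affine hp0 hdil).smul _
  have hHhol : MDifferentiable 𝓘(ℂ) 𝓘(ℂ) H := by
    refine MDifferentiable.sum fun x _ => ?_
    rcases eq_or_ne x 0 with rfl | hx
    · rw [MulChar.map_zero, zero_smul]
      exact mdifferentiable_const
    · exact (hholx x hx).const_smul _
  have hHmer : MeromorphicAtCusps k H := by
    refine MeromorphicAtCusps.sum fun x _ => ?_
    rcases eq_or_ne x 0 with rfl | hx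
    · rw [MulChar.map_zero, zero_smul]
      intro M
      rw [SlashAction.zero_slash]
      exact .zero
    · exact (hmerx x hx).smul _
  have hexp : ∀ x ≠ 0, ∃ c : ℚ → ℂ,
      (∀ n, c n ≠ 0 → ((n : ℚ) : AddCircle (1 : ℚ)) = -(Q (e.symm x))) ∧
        HasFourierExpansion (f x) c := fun x hx => by
    rw [hrec x hx]
    refine ⟨_, fun n hn => ?_, ((component_hasQExpansion hα hc x).hasFourierExpansion
      (Fact.out : p.Prime).pos fun τ => by simp [coe_dilate]).smul _⟩
    have hn' := right_ne_zero_of_mul hn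
    by_cases hm : ∃ m : ℤ, (m : ℚ) / p = n
    · obtain ⟨m, rfl⟩ := hm
      rw [(injective_intCast_div (Fact.out : p.Prime).pos).extend_apply] at hn'
      rw [coe_div_eq_neg_Q_iff hα]
      by_contra h
      exact hn' (if_neg h)
    · exact absurd (Function.extend_apply' _ _ _ hm) hn'
  have hTx : ∀ x ≠ 0, f x ∣[k] ModularGroup.T
      = (ZMod.stdAddChar (-((α : ZMod p) * x ^ 2)) : ℂ) • f x := fun x hx => by
    obtain ⟨c, hc, hfc⟩ := hexp x hx
    funext τ
    rw [slash_T_apply, hfc.apply_T_smul hc, eQZ_neg, eQZ_Q hα, AddChar.map_neg_eq_inv]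
    rfl
  have hT0 : f 0 ∣[k] ModularGroup.T = f 0 := by
    by_cases h1 : χ (-1) = 1
    · refine zero_component_slash_T hp ?_ (alpha_ne_zero hQ hα) (gauss_eq_eSig8 hp hQ hα)
        (Complex.exp_ne_zero _) hTx hS
      rintro rfl
      refine hex ⟨rfl, MulChar.ext fun u => ?_⟩
      rw [MulChar.one_apply u.isUnit]
      rcases eq_one_or_neg_one_of_zmod_three u u.ne_zero with h | h
      · rw [h, map_one]
      · rw [h, h1]
    · -- for odd `χ` the zero component vanishes altogether
      have hH0 : H = 0 := by
        have h2 : (χ (-1) - 1) • H = 0 := by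
          rw [sub_smul, one_smul, ← hpar, sub_self]
        exact (smul_eq_zero.1 h2).resolve_left (sub_ne_zero.2 h1)
      rw [h0, hH0]
      simp
  refine (mem_weakForms_iff hα).2 ⟨fun x => ?_, fun x => ?_, hS, fun x => ?_⟩
  · rcases eq_or_ne x 0 with rfl | hx
    · rw [← hf, h0]
      exact ((hHhol.slash k _).const_smul _).add (hHhol.const_smul _)
    · exact hholx x hx
  · rcases eq_or_ne x 0 with rfl | hx
    · rw [← hf, hT0]
      simp
    · exact hTx x hx
  · rcases eq_or_ne x 0 with rfl | hx
    · have h0mer : MeromorphicAtCusps k (f 0) := by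
        rw [h0]
        exact ((hHmer.slash _).smul _).add (hHmer.smul _)
      rw [map_zero, QuadraticMap.map_zero, neg_zero]
      refine h0mer.meromorphicAtInfty.integral_exponents fun τ => ?_
      rw [← slash_T_apply k (f 0), hT0]
    · exact hexp x hx

end Backward

end TwistedSum

theorem proposition3p3 {A : Type*} [AddCommGroup A] [Fintype A] [DecidableEq A]
    (Q : QuadraticMap ℤ A (AddCircle (1 : ℚ))) (hQ : IsNondegenerate Q)
    (p : ℕ) [Fact p.Prime] (hp : p ≠ 2)
    -- the identification of `A` with `ℤ/pℤ`, under which `Q(γ) = αγ²/p`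
    (e : A ≃+ ZMod p) (α : ℤ)
    (hα : ∀ n : ℤ, Q (e.symm (n : ZMod p)) = ((α * n ^ 2 / p : ℚ) : AddCircle (1 : ℚ)))
    (k : ℤ) (χ : DirichletCharacter ℂ p) (hχ : χ (-1) = (-1) ^ (k + halfSig Q)) :
    -- `φ_χ` maps `A_k(ρ*)` to `A_k^{ε,AL}(p², χ ⊗ χ_p)`, and `F` is recovered from `φ_χ(F)`
    (∀ F ∈ weakForms Q k, twistedComponentSum e χ F ∈ epsALForms Q e α k χ ∧
      reconstruct Q e k χ (twistedComponentSum e χ F) = F) ∧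
    -- `φ_χ` is an isomorphism with the given inverse
    (¬ (p = 3 ∧ χ = 1) →
      ∃ Φ : weakForms Q k ≃ₗ[ℂ] epsALForms Q e α k χ,
        (∀ F, (Φ F : ℍ → ℂ) = twistedComponentSum e χ F) ∧
        ∀ G, (Φ.symm G : ℍ → A → ℂ) = reconstruct Q e k χ G) := by
  have hforward : ∀ F ∈ weakForms Q k, twistedComponentSum e χ F ∈ epsALForms Q e α k χ :=
    fun F hF => ⟨twistedComponentSum_mem_scalarForms hQ hp hα hF,
      (component_twistedComponentSum hQ hp hα hχ hF).1,
      atkinLehner_twistedComponentSum hQ hp hα hχ hF⟩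
  refine ⟨fun F hF => ⟨hforward F hF, reconstruct_twistedComponentSum hQ hp hα hχ hF⟩,
    fun hex => ?_⟩
  refine ⟨{ toFun := fun F => ⟨twistedComponentSum e χ F, hforward F F.2⟩
            invFun := fun G => ⟨reconstruct Q e k χ G, reconstruct_mem_weakForms hQ hp hα hχ hex G.2⟩
            map_add' := fun F F' => Subtype.ext <| funext fun τ => ?_
            map_smul' := fun a F => Subtype.ext <| funext fun τ => ?_
            left_inv := fun F => Subtype.ext <|
              reconstruct_twistedComponentSum hQ hp hα hχ F.2
            right_inv := fun G => Subtype.ext <|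
              twistedComponentSum_reconstruct hQ hp hα G.2.2.1 }, fun _ => rfl, fun _ => rfl⟩
  · simp [twistedComponentSum, mul_add, Finset.sum_add_distrib]
  · simp only [twistedComponentSum, Submodule.coe_smul, Pi.smul_apply, smul_eq_mul, Finset.mul_sum,
      mul_left_comm, RingHom.id_apply]
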